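/- Notation. For $n\ge 1$, a permutation $a_1a_2\cdots a_n\in\mathfrak S_n$ (one-line notation) is identified with the point $(a_1,\dots,a_n)\in\mathbb R^n$, and $\Pi_n$ is the convex hull of these $n!$ points. For $u\le v$ in the strong Bruhat order of $\mathfrak S_n$ let $P_{[u,v]}$ be the convex hull of the permutations $z$ with $u\le z\le v$ (a Bruhat interval polytope). Let $e=12\cdots n$ and $\omega=n\cdots 21$. For $A\subseteq[n]$ let $\overrightarrow A$, $\overleftarrow A$ be the increasing and decreasing sequence of the elements of $A$, and let $e_A$, $\omega_A$ be obtained from $e$, $\omega$ by deleting the values in $A$; juxtaposition is concatenation, and $r$ is written for $\{r\}$ in subscripts. For $k$-subsets $U=\{u_1<\dots<u_k\}$, $L=\{l_1<\dots<l_k\}$ of $[n]$ write $U\le_G L$ if $u_i\le l_i$ for all $i$; if $U\le_G L$, the lattice path matroid $M[U,L]$ is the matroid on $[n]$ with bases all $B$ such that $U\le_G B\le_G L$. A lattice path flag matroid (LPFM) on $[n]$ is a sequence $M_1,\dots,M_n$ of lattice path matroids on $[n]$, $M_k$ of rank $k$, such that every flat of $M_k$ is a flat of $M_{k+1}$ for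 $1\le k<n$; its polytope is the Minkowski sum of the matroid base polytopes of $M_1,\dots,M_n$. For a hyperplane $H=\{f=c\}$, put $H^{\le}=\{f\le c\}$ and $H^{\ge}=\{f\ge c\}$. We say that $H$ splits a polytope $P$ if there is a polytopal subdivision of $P$, without new vertices, with exactly two maximal cells $P\cap H^{\le}\neq P\cap H^{\ge}$, such that $P\cap H$ has codimension one in $P$ and has affine span $H\cap\operatorname{aff}(P)$. Theorem. Let $n\ge 3$. Each of the following hyperplanes $H$ splits $\Pi_n$ into two Bruhat interval polytopes, each of which is the polytope of an LPFM. The cells are as follows (in each case the lower end of the interval is below the upper end in Bruhat order). (T1) $H: x_1+\dots+x_j=\binom{j+1}{2}+1$ with $1\le j\le n-2$: for $A=[j-1]\cup\{j+1\}$, $$\Pi_n\cap H^{\le}=P_{[e,\overleftarrow A\omega_A]},\qquad \Pi_n\cap H^{\ge}=P_{[\overrightarrow A e_A,\omega]}.$$ (T2) $H: x_1+\dots+x_j=n+(n-1)+\dots+(n-j+2)+(n-j)$ with $1\le j\le n-2$ (the right-hand side is $n-1$ for $j=1$): for $B=\{n-j\}\cup\{n-j+2,\dots,n\}$, $$\Pi_n\cap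 H^{\le}=P_{[e,\overleftarrow B\omega_B]},\qquad \Pi_n\cap H^{\ge}=P_{[\overrightarrow B e_B,\omega]}.$$ (T3) $H: x_i=r$ with $i\in\{1,n\}$ and $2\le r\le n-1$: for $i=1$, $$\Pi_n\cap H^{\le}=P_{[e,\,r\omega_r]},\qquad \Pi_n\cap H^{\ge}=P_{[r e_r,\,\omega]},$$ and for $i=n$, $$\Pi_n\cap H^{\le}=P_{[e_r r,\,\omega]},\qquad \Pi_n\cap H^{\ge}=P_{[e,\,\omega_r r]}.$$ -/

import Mathlib

open scoped Pointwise

/-! ### Polytopes, polytopal subdivisions, splits -/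

section Polytopes

variable {E : Type*} [AddCommGroup E] [Module ℝ E]

/-- A polytope: the convex hull of a finite set of points. -/
def IsPolytope (P : Set E) : Prop :=
  ∃ s : Set E, s.Finite ∧ P = convexHull ℝ s

/-- `G` is a face of the polytope `P` (the empty face and `P` itself included):
a convex extreme subset of `P`. -/
def IsPolytopeFace (P G : Set E) : Prop :=
  Convex ℝ G ∧ IsExtreme ℝ P G

/-- `S` is a polytopal subdivision of `P`: a finite family of polytopes, closed under taking
faces, any two of which meet in a common face, and whose union is `P`. -/
structure IsPolytopalSubdivision (P : Set E) (S : Set (Set E)) : Prop where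
  finite : S.Finite
  isPolytope : ∀ F ∈ S, IsPolytope F
  face_mem : ∀ F ∈ S, ∀ G, IsPolytopeFace F G → G ∈ S
  inter_face : ∀ F ∈ S, ∀ G ∈ S, IsPolytopeFace F (F ∩ G) ∧ IsPolytopeFace G (F ∩ G)
  sUnion_eq : ⋃₀ S = P

/-- The subdivision `S` of `P` has no new vertices: each vertex of a cell is a vertex of `P`. -/
def NoNewVertices (P : Set E) (S : Set (Set E)) : Prop :=
  ∀ F ∈ S, F.extremePoints ℝ ⊆ P.extremePoints ℝ

/-- The dimension of a set: the dimension of its affine span. -/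
noncomputable def affDim (P : Set E) : ℕ :=
  Module.finrank ℝ (affineSpan ℝ P).direction

/-- The hyperplane `H = {x | f x = c}` gives rise to a split of the polytope `P` with maximal
cells `F₁ = P ∩ H^≤` and `F₂ = P ∩ H^≥`: there is a polytopal subdivision of `P` without new
vertices whose maximal cells are exactly the two distinct sets `F₁`, `F₂`; their intersection has
codimension one in `P`, and `H` is the hyperplane which it spans (inside the affine span
of `P`, which need not be all of the ambient space). -/
structure IsHyperplaneSplit (P : Set E) (f : E →ₗ[ℝ] ℝ) (c : ℝ) (F₁ F₂ : Set E) : Prop where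
  isPolytope : IsPolytope P
  ne_zero : f ≠ 0
  left_eq : F₁ = P ∩ {x | f x ≤ c}
  right_eq : F₂ = P ∩ {x | c ≤ f x}
  ne : F₁ ≠ F₂
  exists_subdivision : ∃ S : Set (Set E), IsPolytopalSubdivision P S ∧ NoNewVertices P S ∧
    {F | Maximal (· ∈ S) F} = {F₁, F₂}
  codim_one : affDim (F₁ ∩ F₂) + 1 = affDim P
  span_eq : (affineSpan ℝ (F₁ ∩ F₂) : Set E) = {x | f x = c} ∩ affineSpan ℝ P

end Polytopes

/-! ### The symmetric group, its Bruhat order, Bruhat interval polytopes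

The ground set `[n] = {1, …, n}` is represented by `Fin n`; the element `a : Fin n` stands for the
number `a + 1`. -/

section Bruhat

variable {n : ℕ}

/-- A simple transposition `(i, i+1)`. -/
def IsSimpleTransposition (s : Equiv.Perm (Fin n)) : Prop :=
  ∃ i j : Fin n, (i : ℕ) + 1 = j ∧ s = Equiv.swap i j

/-- The length of `u`: the least number of factors in an expression of `u` as a product of
simple transpositions. -/
noncomputable def permLength (u : Equiv.Perm (Fin n)) : ℕ :=
  sInf {k | ∃ l : List (Equiv.Perm (Fin n)),
    (∀ s ∈ l, IsSimpleTransposition s) ∧ l.prod = u ∧ l.length = k}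

/-- The relation `u ⋖ v`: `ℓ(v) = ℓ(u) + 1` and `v = (i, j) u` for some `i < j`. -/
def BruhatCovers (u v : Equiv.Perm (Fin n)) : Prop :=
  permLength v = permLength u + 1 ∧ ∃ i j : Fin n, i < j ∧ Equiv.swap i j * u = v

/-- The (strong) Bruhat order: the reflexive transitive closure of the covering relation. -/
def BruhatLE (u v : Equiv.Perm (Fin n)) : Prop :=
  Relation.ReflTransGen BruhatCovers u v

/-- The permutation `u = a₁ ⋯ aₙ` (one-line notation) as the point `(a₁, …, aₙ)` of `ℝⁿ`. -/
def permPoint (u : Equiv.Perm (Fin n)) : Fin n → ℝ :=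
  fun i => ((u i : ℕ) : ℝ) + 1

/-- The permutahedron `Π_n`. -/
def permutahedron (n : ℕ) : Set (Fin n → ℝ) :=
  convexHull ℝ (Set.range (permPoint (n := n)))

/-- The polytope `P_{[u,v]}` spanned by the Bruhat interval `[u,v]`. -/
def bruhatIntervalPolytope (u v : Equiv.Perm (Fin n)) : Set (Fin n → ℝ) :=
  convexHull ℝ (permPoint '' {z | BruhatLE u z ∧ BruhatLE z v})

end Bruhat

/-! ### Lattice path matroids and flags of them -/

section LatticePath

variable {n : ℕ}

/-- Gale order: `A ≤_G B` if `A = {a₁ < ⋯ < a_k}`, `B = {b₁ < ⋯ < b_k}` have the same size and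
`a_i ≤ b_i` for all `i`. -/
def GaleLE (A B : Finset (Fin n)) : Prop :=
  ∃ (k : ℕ) (hA : A.card = k) (hB : B.card = k),
    ∀ i : Fin k, A.orderEmbOfFin hA i ≤ B.orderEmbOfFin hB i

/-- `M` is the lattice path matroid `M[U, L]` on `[n]`. -/
def IsLatticePathMatroid (M : Matroid (Fin n)) (U L : Finset (Fin n)) : Prop :=
  GaleLE U L ∧ M.E = Set.univ ∧
    ∀ B : Finset (Fin n), M.IsBase (B : Set (Fin n)) ↔ GaleLE U B ∧ GaleLE B L

/-- `M` is a quotient of `N` (matroids on the same ground set): every flat of `M` is a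
flat of `N`. -/
def IsMatroidQuotient (M N : Matroid (Fin n)) : Prop :=
  M.E = N.E ∧ ∀ F : Set (Fin n), M.IsFlat F → N.IsFlat F

/-- A lattice path flag matroid (LPFM): a full flag `M₁ ≤_q M₂ ≤_q ⋯ ≤_q M_n` of lattice path
matroids on `[n]`, where `M_k` has rank `k`. The constituent `M_{i+1}` has index `i : Fin n`. -/
def IsLPFM (M : Fin n → Matroid (Fin n)) : Prop :=
  (∀ i : Fin n, ∃ U L : Finset (Fin n), U.card = (i : ℕ) + 1 ∧ L.card = (i : ℕ) + 1 ∧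
    IsLatticePathMatroid (M i) U L) ∧
  ∀ i j : Fin n, (i : ℕ) + 1 = j → IsMatroidQuotient (M i) (M j)

/-- The matroid base polytope: the convex hull of the indicator vectors of the bases. -/
noncomputable def matroidPolytope (M : Matroid (Fin n)) : Set (Fin n → ℝ) :=
  convexHull ℝ ((fun B : Set (Fin n) => B.indicator (fun _ => (1 : ℝ))) '' {B | M.IsBase B})

/-- The flag matroid polytope: the Minkowski sum of the polytopes of the constituents. -/
noncomputable def flagMatroidPolytope (M : Fin n → Matroid (Fin n)) : Set (Fin n → ℝ) :=
  ∑ i, matroidPolytope (M i)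

/-- `P` is the flag matroid polytope of an LPFM. -/
def IsLPFMPolytope (P : Set (Fin n → ℝ)) : Prop :=
  ∃ M : Fin n → Matroid (Fin n), IsLPFM M ∧ P = flagMatroidPolytope M

end LatticePath

/-! ### Permutations in one-line notation -/

section OneLine

variable {n : ℕ}

/-- The permutation whose one-line notation is the list `l`. -/
def ofOneLine (l : List (Fin n)) (hn : l.Nodup) (hm : ∀ x, x ∈ l) : Equiv.Perm (Fin n) :=
  (finCongr (by
    have h := Fintype.card_congr (hn.getEquivOfForallMemList l hm)
    simpa using h.symm)).trans (hn.getEquivOfForallMemList l hm)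

/-- The increasing sequence of `A`. -/
def incSeq (A : Finset (Fin n)) : List (Fin n) := A.sort (· ≤ ·)

/-- The decreasing sequence of `A`. -/
def decSeq (A : Finset (Fin n)) : List (Fin n) := A.sort (· ≥ ·)

/-- `e_A`: delete the values of `A` from `e = 1 2 ⋯ n`. -/
def eDel (A : Finset (Fin n)) : List (Fin n) := (List.finRange n).filter (· ∉ A)

/-- `ω_A`: delete the values of `A` from `ω = n ⋯ 2 1`. -/
def omegaDel (A : Finset (Fin n)) : List (Fin n) := (List.finRange n).reverse.filter (· ∉ A)

/-- The permutation obtained by writing the increasing sequence of `A`, then `e_A`. -/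
def incThenE (A : Finset (Fin n)) : Equiv.Perm (Fin n) :=
  ofOneLine (incSeq A ++ eDel A)
    (by
      refine List.Nodup.append (Finset.sort_nodup _ _) ((List.nodup_finRange n).filter _) ?_
      intro x hx hy
      simp_all [incSeq, eDel])
    (by intro x; by_cases h : x ∈ A <;> simp [incSeq, eDel, h])

/-- The permutation obtained by writing the decreasing sequence of `A`, then `ω_A`. -/
def decThenOmega (A : Finset (Fin n)) : Equiv.Perm (Fin n) :=
  ofOneLine (decSeq A ++ omegaDel A)
    (by
      refine List.Nodup.append (Finset.sort_nodup _ _)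
        ((List.nodup_reverse.2 (List.nodup_finRange n)).filter _) ?_
      intro x hx hy
      simp_all [decSeq, omegaDel])
    (by intro x; by_cases h : x ∈ A <;> simp [decSeq, omegaDel, h])

/-- The permutation obtained by writing `e_A`, then the increasing sequence of `A`. -/
def eThenInc (A : Finset (Fin n)) : Equiv.Perm (Fin n) :=
  ofOneLine (eDel A ++ incSeq A)
    (by
      refine List.Nodup.append ((List.nodup_finRange n).filter _) (Finset.sort_nodup _ _) ?_
      intro x hx hy
      simp_all [incSeq, eDel])
    (by intro x; by_cases h : x ∈ A <;> simp [incSeq, eDel, h])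

/-- The permutation obtained by writing `ω_A`, then the decreasing sequence of `A`. -/
def omegaThenDec (A : Finset (Fin n)) : Equiv.Perm (Fin n) :=
  ofOneLine (omegaDel A ++ decSeq A)
    (by
      refine List.Nodup.append ((List.nodup_reverse.2 (List.nodup_finRange n)).filter _)
        (Finset.sort_nodup _ _) ?_
      intro x hx hy
      simp_all [decSeq, omegaDel])
    (by intro x; by_cases h : x ∈ A <;> simp [decSeq, omegaDel, h])

/-- The longest permutation `ω = n ⋯ 2 1`; the identity `e` is `1 : Equiv.Perm (Fin n)`. -/
def longestPerm (n : ℕ) : Equiv.Perm (Fin n) := Fin.revPerm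

/-- The set `[j-1] ∪ {j+1}`. -/
def setT1 (n j : ℕ) : Finset (Fin n) :=
  Finset.univ.filter fun a => (a : ℕ) + 1 ≤ j - 1 ∨ (a : ℕ) + 1 = j + 1

/-- The set `{n-j} ∪ {n-j+2, …, n}`. -/
def setT2 (n j : ℕ) : Finset (Fin n) :=
  Finset.univ.filter fun a => (a : ℕ) + 1 = n - j ∨ n - j + 2 ≤ (a : ℕ) + 1

/-- The set `{r} ⊆ [n]`. -/
def setT3 (n r : ℕ) : Finset (Fin n) :=
  Finset.univ.filter fun a => (a : ℕ) + 1 = r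

end OneLine

/-! ### The hyperplanes -/

/-- The linear form `x_1 + ⋯ + x_j` on `ℝⁿ`. -/
def prefixSum (n j : ℕ) : (Fin n → ℝ) →ₗ[ℝ] ℝ :=
  ∑ i ∈ Finset.univ.filter (fun i : Fin n => (i : ℕ) + 1 ≤ j), LinearMap.proj i

/-- The hyperplane `f = c` splits `Π_n` into the two Bruhat interval polytopes
`P_{[u₁,v₁]} = Π_n ∩ {f ≤ c}` and `P_{[u₂,v₂]} = Π_n ∩ {f ≥ c}`, and both are polytopes of LPFMs. -/
structure SplitsIntoLPFMs (n : ℕ) (f : (Fin n → ℝ) →ₗ[ℝ] ℝ) (c : ℝ)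
    (u₁ v₁ u₂ v₂ : Equiv.Perm (Fin n)) : Prop where
  split : IsHyperplaneSplit (permutahedron n) f c
    (bruhatIntervalPolytope u₁ v₁) (bruhatIntervalPolytope u₂ v₂)
  le_left : BruhatLE u₁ v₁
  le_right : BruhatLE u₂ v₂
  lpfm_left : IsLPFMPolytope (bruhatIntervalPolytope u₁ v₁)
  lpfm_right : IsLPFMPolytope (bruhatIntervalPolytope u₂ v₂)

/-! ### Faces of polytopes and their sections by a hyperplane. -/

section PolytopeFaces

variable {E : Type*} [AddCommGroup E] [Module ℝ E]

/-! Let `J` be a set of positions and `A` a set of values of the same size. Cutting the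
permutahedron at `∑ i ∈ J, x_i = ∑ a ∈ A, (a + 1)` creates no new vertices
(`permutahedron_inter_halfSpace`). Indeed, maximize a linear form on the side `≤`: as a Lagrange
multiplier on `J` grows, each tie between adjacent values allows a swap that lowers the sum on `J`
by exactly one, so the bound is met exactly at a permutation, and the multiplier certifies
optimality. The side `≥` is the side `≤` for the complements, since the sum of all coordinates is
constant.

If `A` is Gale-comparable with every set of its size, this single inequality selects the same
permutations `z` as the Gale inequalities between `z(J)` and `A` (`GaleComparable.dominated_eq`).
This holds for the second least set (T1), the second greatest set (T2), and singletons and their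
complements (T3).

For an initial segment `J`, the dominated permutations are those below `decThenOmega A` in Bruhat
order (`bruhatLE_decThenOmega_iff`); multiplication by `ω` gives the upper intervals.

A permutation point is the sum of the indicators of its sets of top positions. Domination bounds how
many elements of `J` each of these sets contains, which makes them bases of matroids
`flagConstituent J A i`. Conversely every sum of bases satisfies the inequality of the cut, so the
cell is the flag matroid polytope (`flagMatroidPolytope_flagConstituent`). These matroids form a
flag of quotients, and they are lattice path matroids when `J` is an initial or final segment. -/

theorem IsPolytopeFace.refl_of_convex {P : Set E} (hP : Convex ℝ P) : IsPolytopeFace P P :=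
  ⟨hP, IsExtreme.refl ℝ P⟩

theorem IsPolytopeFace.trans {P F G : Set E} (hF : IsPolytopeFace P F) (hG : IsPolytopeFace F G) :
    IsPolytopeFace P G :=
  ⟨hG.1, hF.2.trans hG.2⟩

theorem IsPolytopeFace.inter {P F G : Set E} (hF : IsPolytopeFace P F) (hG : IsPolytopeFace P G) :
    IsPolytopeFace P (F ∩ G) :=
  ⟨hF.1.inter hG.1, hF.2.inter hG.2⟩

theorem IsPolytopeFace.mono {P F G : Set E} (hG : IsPolytopeFace P G) (hFP : F ⊆ P) (hGF : G ⊆ F) :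
    IsPolytopeFace F G :=
  ⟨hG.1, hG.2.mono hFP hGF⟩

/-- A face of a polytope is spanned by the generators of the polytope which it contains. -/
theorem IsPolytopeFace.eq_convexHull {s G : Set E} (hG : IsPolytopeFace (convexHull ℝ s) G) :
    G = convexHull ℝ (s ∩ G) := by
  refine Set.Subset.antisymm ?_ (convexHull_min Set.inter_subset_right hG.1)
  -- The complement of a face in a convex set is convex, so the generators outside `G` span only
  -- points outside `G`.
  have hdiff : convexHull ℝ (s \ G) ⊆ convexHull ℝ s \ G := by
    refine convexHull_min ?_ (hG.2.convex_sdiff (convex_convexHull ℝ s))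
    exact fun x hx => ⟨subset_convexHull ℝ s hx.1, hx.2⟩
  intro x hx
  have hxs := hG.2.subset hx
  rcases (s ∩ G).eq_empty_or_nonempty with h1 | h1
  · have : s \ G = s := by
      ext y
      have hy : y ∉ s ∩ G := by simp [h1]
      exact ⟨fun h => h.1, fun h => ⟨h, fun h' => hy ⟨h, h'⟩⟩⟩
    rw [this] at hdiff
    exact absurd hx (hdiff hxs).2
  rcases (s \ G).eq_empty_or_nonempty with h2 | h2
  · have : s ∩ G = s := Set.inter_eq_left.2 (Set.sdiff_eq_empty.1 h2)
    rwa [this]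
  -- Now `x` lies on a segment from the hull of `s ∩ G` to the hull of `s \ G`. An interior point of
  -- it in `G` would pull the second endpoint into `G`.
  rw [← Set.inter_union_sdiff s G, convexHull_union h1 h2, mem_convexJoin] at hxs
  obtain ⟨a, ha, b, hb, hab⟩ := hxs
  have hb' := hdiff hb
  have ha' : a ∈ convexHull ℝ s := convexHull_mono Set.inter_subset_left ha
  rw [← insert_endpoints_openSegment] at hab
  rcases hab with rfl | rfl | hab
  · exact ha
  · exact absurd hx hb'.2
  · exact absurd (hG.2.right_mem_of_mem_openSegment ha' hb'.1 hx hab) hb'.2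

theorem finite_setOf_isPolytopeFace {s : Set E} (hs : s.Finite) :
    {G | IsPolytopeFace (convexHull ℝ s) G}.Finite := by
  refine ((hs.finite_subsets).image (convexHull ℝ)).subset ?_
  intro G hG
  exact ⟨s ∩ G, Set.inter_subset_left, (IsPolytopeFace.eq_convexHull hG).symm⟩

theorem isPolytopeFace_inter_hyperplane {P : Set E} (hP : Convex ℝ P) (f : E →ₗ[ℝ] ℝ) (c : ℝ)
    (h : ∀ x ∈ P, f x ≤ c) : IsPolytopeFace P (P ∩ {x | f x = c}) := by
  refine ⟨hP.inter (convex_hyperplane f.isLinear c), Set.inter_subset_left, ?_⟩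
  rintro x hx y hy z ⟨-, hz⟩ ⟨a, b, ha, hb, hab, rfl⟩
  refine ⟨hx, ?_⟩
  simp only [Set.mem_ofPred_eq, map_add, map_smul, smul_eq_mul] at hz ⊢
  have h1 := h x hx
  have h2 := h y hy
  by_contra hne
  have h3 : f x < c := lt_of_le_of_ne h1 hne
  have h4 : a * f x + b * f y < (a + b) * c := by nlinarith
  rw [hab] at h4
  linarith

/-- The point of the segment from `x` to `y` on a hyperplane which separates `x` and `y`. -/
theorem exists_mem_segment_hyperplane (f : E →ₗ[ℝ] ℝ) {c : ℝ} {x y : E} (hx : f x ≤ c)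
    (hy : c < f y) : ∃ t : ℝ, 0 ≤ t ∧ t < 1 ∧ f ((1 - t) • x + t • y) = c := by
  have h : 0 < f y - f x := by linarith
  refine ⟨(c - f x) / (f y - f x), div_nonneg (by linarith) h.le, ?_, ?_⟩
  · rw [div_lt_one h]; linarith
  · simp only [map_add, map_smul, smul_eq_mul]
    field_simp
    ring

/-- A point below the hyperplane is on the line through `y` and a point of the section. This applies
to `x` too, and then lines through `x` reach the points above. -/
theorem subset_affineSpan_insert_hyperplane {P : Set E} (hP : Convex ℝ P) (f : E →ₗ[ℝ] ℝ) {c : ℝ}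
    {x y : E} (hx : x ∈ P) (hy : y ∈ P) (hxc : f x < c) (hyc : c < f y) :
    P ⊆ affineSpan ℝ (insert y (P ∩ {x | f x = c})) := by
  set Q := affineSpan ℝ (insert y (P ∩ {x | f x = c})) with hQ
  have hyQ : y ∈ Q := subset_affineSpan ℝ _ (Set.mem_insert _ _)
  have hDQ : ∀ z ∈ P, f z = c → z ∈ Q := fun z hz hzc =>
    subset_affineSpan ℝ _ (Set.mem_insert_of_mem _ ⟨hz, hzc⟩)
  have key : ∀ z ∈ P, f z ≤ c → z ∈ Q := by
    intro z hz hzc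
    obtain ⟨t, ht0, ht1, ht⟩ := exists_mem_segment_hyperplane f hzc hyc
    have hw := hDQ _ (hP hz hy (by linarith : (0 : ℝ) ≤ 1 - t) ht0 (by ring)) ht
    -- With `w = (1 - t) z + t y`, the line from `y` to `w` reaches `z` at parameter `1 / (1 - t)`.
    have h := AffineMap.lineMap_mem (1 / (1 - t)) hyQ hw
    convert h using 1
    have : (1 - t) ≠ 0 := by linarith
    rw [AffineMap.lineMap_apply_module]
    match_scalars <;> field_simp
    ring
  intro z hz
  rcases le_or_gt (f z) c with h | h
  · exact key z hz h
  · change z ∈ Q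
    have hxQ := key x hx hxc.le
    obtain ⟨t, ht0, ht1, ht⟩ := exists_mem_segment_hyperplane f hxc.le h
    have htpos : t ≠ 0 := by
      rintro rfl
      simp at ht
      exact hxc.ne ht
    have hw := hDQ _ (hP hx hz (by linarith : (0 : ℝ) ≤ 1 - t) ht0 (by ring)) ht
    have h := AffineMap.lineMap_mem (1 / t) hxQ hw
    convert h using 1
    rw [AffineMap.lineMap_apply_module]
    match_scalars <;> field_simp
    ring

/-- The section together with `y` spans `P`. A point `r (y - h) + p`, with `h` and `p` in the span
of the section, has `f = c` only if `r = 0`, because `f y > c`. -/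
theorem affineSpan_inter_hyperplane {P : Set E} (hP : Convex ℝ P) (f : E →ₗ[ℝ] ℝ) {c : ℝ}
    {x y : E} (hx : x ∈ P) (hy : y ∈ P) (hxc : f x < c) (hyc : c < f y) :
    (affineSpan ℝ (P ∩ {x | f x = c}) : Set E) = {x | f x = c} ∩ affineSpan ℝ P := by
  obtain ⟨t, ht0, ht1, ht⟩ := exists_mem_segment_hyperplane f hxc.le hyc
  set h := (1 - t) • x + t • y with hh
  have hhD : h ∈ P ∩ {x | f x = c} :=
    ⟨hP hx hy (by linarith : (0 : ℝ) ≤ 1 - t) ht0 (by ring), ht⟩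
  have hhA := subset_affineSpan ℝ _ hhD
  have hsub : ∀ z ∈ affineSpan ℝ (P ∩ {x | f x = c}), f z = c := by
    intro z hz
    refine affineSpan_induction hz (fun z hz => hz.2) ?_
    intro a u v w hu hv hw
    simp [hu, hv, hw]
  apply Set.Subset.antisymm
  · exact fun z hz => ⟨hsub z hz, affineSpan_mono ℝ Set.inter_subset_left hz⟩
  · rintro z ⟨hz, hzP⟩
    have hz' := (affineSpan_le.2 (subset_affineSpan_insert_hyperplane hP f hx hy hxc hyc)) hzP
    rw [← affineSpan_insert_affineSpan, AffineSubspace.mem_affineSpan_insert_iff hhA] at hz'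
    obtain ⟨r, p, hp, rfl⟩ := hz'
    have hfp := hsub p hp
    have hfh : f h = c := ht
    simp only [Set.mem_ofPred_eq, vsub_eq_sub, vadd_eq_add, map_add, map_smul, map_sub, hfp,
      hfh, smul_eq_mul, add_eq_right, mul_eq_zero] at hz
    rcases hz with hz | hz
    · simpa [hz] using hp
    · linarith

/-- The direction of the section is the kernel of `f` on the direction of `P`, and `f` does not
vanish on `y - x`. -/
theorem affDim_inter_hyperplane [FiniteDimensional ℝ E] {P : Set E} (hP : Convex ℝ P)
    (f : E →ₗ[ℝ] ℝ) {c : ℝ} {x y : E} (hx : x ∈ P) (hy : y ∈ P) (hxc : f x < c) (hyc : c < f y) :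
    affDim (P ∩ {x | f x = c}) + 1 = affDim P := by
  obtain ⟨t, ht0, ht1, ht⟩ := exists_mem_segment_hyperplane f hxc.le hyc
  have hhD : (1 - t) • x + t • y ∈ P ∩ {x | f x = c} :=
    ⟨hP hx hy (by linarith : (0 : ℝ) ≤ 1 - t) ht0 (by ring), ht⟩
  set h := (1 - t) • x + t • y with hh
  have hhA := subset_affineSpan ℝ _ hhD
  have hhP := subset_affineSpan ℝ _ hhD.1
  have hspan := affineSpan_inter_hyperplane hP f hx hy hxc hyc
  set V := (affineSpan ℝ P).direction with hV
  have hdir : (affineSpan ℝ (P ∩ {x | f x = c})).direction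
      = (LinearMap.ker (f.domRestrict V)).map V.subtype := by
    ext v
    rw [← AffineSubspace.vadd_mem_iff_mem_direction v hhA, ← SetLike.mem_coe, hspan]
    have hfh : f h = c := ht
    simp only [Set.mem_inter_iff, Set.mem_ofPred_eq, SetLike.mem_coe,
      AffineSubspace.vadd_mem_iff_mem_direction v hhP]
    simp only [vadd_eq_add, map_add, hfh, add_eq_right, Submodule.mem_map, LinearMap.mem_ker,
      LinearMap.domRestrict_apply, Submodule.subtype_apply, Subtype.exists, exists_and_left,
      exists_prop, exists_eq_right_right]
    rfl
  have hne : f.domRestrict V ≠ 0 := by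
    intro h0
    have hxy : y - x ∈ V := AffineSubspace.vsub_mem_direction (subset_affineSpan ℝ _ hy)
      (subset_affineSpan ℝ _ hx)
    have := LinearMap.congr_fun h0 ⟨y - x, hxy⟩
    simp only [LinearMap.domRestrict_apply, map_sub, LinearMap.zero_apply] at this
    linarith
  unfold affDim
  rw [hdir, Submodule.finrank_map_subtype_eq]
  exact Module.Dual.finrank_ker_add_one_of_ne_zero hne

end PolytopeFaces

/-! ### From a cut without new vertices to a split. -/

section Splits

variable {E : Type*} [AddCommGroup E] [Module ℝ E] [FiniteDimensional ℝ E]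

/-- A hyperplane which cuts the polytope spanned by `V` into two polytopes spanned by subsets
of `V` splits it, if every point of `V` is a vertex. -/
theorem isHyperplaneSplit_of_convexHull {V V₁ V₂ : Set E} (hV : V.Finite)
    (hext : V ⊆ (convexHull ℝ V).extremePoints ℝ) (h₁ : V₁ ⊆ V) (h₂ : V₂ ⊆ V)
    (f : E →ₗ[ℝ] ℝ) (c : ℝ)
    (hl : convexHull ℝ V₁ = convexHull ℝ V ∩ {x | f x ≤ c})
    (hr : convexHull ℝ V₂ = convexHull ℝ V ∩ {x | c ≤ f x})
    {x y : E} (hx : x ∈ V) (hy : y ∈ V) (hxc : f x < c) (hyc : c < f y) :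
    IsHyperplaneSplit (convexHull ℝ V) f c (convexHull ℝ V₁) (convexHull ℝ V₂) := by
  set P := convexHull ℝ V with hP
  have hPc : Convex ℝ P := convex_convexHull ℝ V
  have hxP : x ∈ P := subset_convexHull ℝ V hx
  have hyP : y ∈ P := subset_convexHull ℝ V hy
  have hx1 : x ∈ convexHull ℝ V₁ := hl ▸ ⟨hxP, hxc.le⟩
  have hy2 : y ∈ convexHull ℝ V₂ := hr ▸ ⟨hyP, hyc.le⟩
  have hx2 : x ∉ convexHull ℝ V₂ := fun h => by
    rw [hr] at h; exact absurd h.2 (not_le.2 hxc)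
  have hy1 : y ∉ convexHull ℝ V₁ := fun h => by
    rw [hl] at h; exact absurd h.2 (not_le.2 hyc)
  have hinter : convexHull ℝ V₁ ∩ convexHull ℝ V₂ = P ∩ {x | f x = c} := by
    rw [hl, hr]; ext z
    simp only [Set.mem_inter_iff, Set.mem_ofPred_eq]
    constructor
    · rintro ⟨⟨h, h1⟩, -, h2⟩; exact ⟨h, le_antisymm h1 h2⟩
    · rintro ⟨h, h1⟩; exact ⟨⟨h, h1.le⟩, h, h1.ge⟩
  set D := convexHull ℝ V₁ ∩ convexHull ℝ V₂ with hD
  have hD1 : IsPolytopeFace (convexHull ℝ V₁) D := by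
    have := isPolytopeFace_inter_hyperplane (convex_convexHull ℝ V₁) f c (fun z hz => by
      rw [hl] at hz; exact hz.2)
    convert this using 1
    rw [hinter, hl]; ext z
    simp only [Set.mem_inter_iff, Set.mem_ofPred_eq]
    constructor
    · rintro ⟨h, h1⟩; exact ⟨⟨h, h1.le⟩, h1⟩
    · rintro ⟨⟨h, -⟩, h1⟩; exact ⟨h, h1⟩
  have hD2 : IsPolytopeFace (convexHull ℝ V₂) D := by
    have := isPolytopeFace_inter_hyperplane (convex_convexHull ℝ V₂) (-f) (-c) (fun z hz => by
      rw [hr] at hz; simpa using hz.2)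
    convert this using 1
    rw [hinter, hr]; ext z
    simp only [Set.mem_inter_iff, Set.mem_ofPred_eq, LinearMap.neg_apply, neg_inj]
    constructor
    · rintro ⟨h, h1⟩; exact ⟨⟨h, h1.ge⟩, h1⟩
    · rintro ⟨⟨h, -⟩, h1⟩; exact ⟨h, h1⟩
  have same : ∀ {W F G : Set E}, IsPolytopeFace W F → IsPolytopeFace W G →
      IsPolytopeFace F (F ∩ G) := fun hF hG =>
    (hF.inter hG).mono hF.2.subset Set.inter_subset_left
  -- Faces of different cells meet inside the common face `A ∩ B`. Their traces there are faces of
  -- it, hence so is their intersection.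
  have cross : ∀ {A B F G : Set E}, IsPolytopeFace A (A ∩ B) → IsPolytopeFace B (A ∩ B) →
      IsPolytopeFace A F → IsPolytopeFace B G →
      IsPolytopeFace F (F ∩ G) ∧ IsPolytopeFace G (F ∩ G) := by
    intro A B F G hA hB hF hG
    have e : (F ∩ (A ∩ B)) ∩ (G ∩ (A ∩ B)) = F ∩ G := by
      ext z
      have a1 : z ∈ F → z ∈ A := fun h => hF.2.subset h
      have a2 : z ∈ G → z ∈ B := fun h => hG.2.subset h
      simp only [Set.mem_inter_iff]
      tauto
    have i1 : IsPolytopeFace (A ∩ B) (F ∩ (A ∩ B)) :=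
      (hF.inter hA).mono hA.2.subset Set.inter_subset_right
    have i2 : IsPolytopeFace (A ∩ B) (G ∩ (A ∩ B)) :=
      (hG.inter hB).mono hB.2.subset Set.inter_subset_right
    have i3 := i1.inter i2
    rw [e] at i3
    exact ⟨(hA.trans i3).mono hF.2.subset Set.inter_subset_left,
      (hB.trans i3).mono hG.2.subset Set.inter_subset_right⟩
  have hspan := affineSpan_inter_hyperplane hPc f hxP hyP hxc hyc
  have hdim := affDim_inter_hyperplane hPc f hxP hyP hxc hyc
  rw [← hinter] at hspan hdim
  -- The subdivision consists of all faces of the two cells.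
  refine ⟨⟨V, hV, rfl⟩, ?_, hl, hr, fun h => hx2 (h ▸ hx1),
    ⟨{F | IsPolytopeFace (convexHull ℝ V₁) F} ∪ {F | IsPolytopeFace (convexHull ℝ V₂) F},
      ⟨?_, ?_, ?_, ?_, ?_⟩, ?_, ?_⟩, hdim, hspan⟩
  · rintro rfl
    simp only [LinearMap.zero_apply] at hxc hyc
    linarith
  · exact (finite_setOf_isPolytopeFace (hV.subset h₁)).union
      (finite_setOf_isPolytopeFace (hV.subset h₂))
  · rintro F (hF | hF)
    · exact ⟨_, (hV.subset h₁).subset Set.inter_subset_left, hF.eq_convexHull⟩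
    · exact ⟨_, (hV.subset h₂).subset Set.inter_subset_left, hF.eq_convexHull⟩
  · rintro F (hF | hF) G hG
    · exact Or.inl (hF.trans hG)
    · exact Or.inr (hF.trans hG)
  · rintro F (hF | hF) G (hG | hG)
    · exact ⟨same hF hG, Set.inter_comm F G ▸ same hG hF⟩
    · exact cross hD1 hD2 hF hG
    · rw [Set.inter_comm F G]
      exact (cross hD1 hD2 hG hF).symm
    · exact ⟨same hF hG, Set.inter_comm F G ▸ same hG hF⟩
  · apply Set.Subset.antisymm
    · rintro z ⟨F, hF | hF, hz⟩
      · have := hF.2.subset hz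
        rw [hl] at this; exact this.1
      · have := hF.2.subset hz
        rw [hr] at this; exact this.1
    · intro z hz
      rcases le_total (f z) c with h | h
      · exact ⟨_, Or.inl (IsPolytopeFace.refl_of_convex (convex_convexHull ℝ V₁)), hl ▸ ⟨hz, h⟩⟩
      · exact ⟨_, Or.inr (IsPolytopeFace.refl_of_convex (convex_convexHull ℝ V₂)), hr ▸ ⟨hz, h⟩⟩
  · rintro F (hF | hF)
    · exact hF.2.extremePoints_subset_extremePoints.trans
        (extremePoints_convexHull_subset.trans (h₁.trans hext))
    · exact hF.2.extremePoints_subset_extremePoints.trans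
        (extremePoints_convexHull_subset.trans (h₂.trans hext))
  · have m1 := IsPolytopeFace.refl_of_convex (convex_convexHull ℝ V₁)
    have m2 := IsPolytopeFace.refl_of_convex (convex_convexHull ℝ V₂)
    ext F
    simp only [Set.mem_ofPred_eq, Set.mem_insert_iff, Set.mem_singleton_iff]
    constructor
    · rintro ⟨hF | hF, hmax⟩
      · exact Or.inl (hF.2.subset.antisymm (hmax (Or.inl m1) hF.2.subset))
      · exact Or.inr (hF.2.subset.antisymm (hmax (Or.inr m2) hF.2.subset))
    · rintro (rfl | rfl)
      · refine ⟨Or.inl m1, ?_⟩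
        rintro G (hG | hG) hle
        · exact hG.2.subset
        · exact absurd (hG.2.subset (hle hx1)) hx2
      · refine ⟨Or.inr m2, ?_⟩
        rintro G (hG | hG) hle
        · exact absurd (hG.2.subset (hle hy2)) hy1
        · exact hG.2.subset

end Splits

/-! ### Length equals the number of inversions. -/

section Inversions

variable {n : ℕ}

/-- The inversions of a permutation, as pairs of positions. -/
def inversions (u : Equiv.Perm (Fin n)) : Finset (Fin n × Fin n) :=
  Finset.univ.filter fun x => x.1 < x.2 ∧ u x.2 < u x.1

theorem mem_inversions {u : Equiv.Perm (Fin n)} {x : Fin n × Fin n} :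
    x ∈ inversions u ↔ x.1 < x.2 ∧ u x.2 < u x.1 := by
  simp [inversions]

theorem card_inversions_lt_mul_swap {u : Equiv.Perm (Fin n)} {P Q : Fin n} (hPQ : P < Q)
    (hu : u P < u Q) : (inversions u).card < (inversions (u * Equiv.swap P Q)).card := by
  set σ := Equiv.swap P Q with hσ
  have hσσ : ∀ x, σ (σ x) = x := fun x => Equiv.swap_apply_self P Q x
  have hP : σ P = Q := Equiv.swap_apply_left P Q
  have hQ : σ Q = P := Equiv.swap_apply_right P Q
  have hr : ∀ x, x ≠ P → x ≠ Q → σ x = x := fun x h1 h2 => Equiv.swap_apply_of_ne_of_ne h1 h2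
  -- Move an inversion along `σ` if `σ` keeps the order of its positions, and leave it alone
  -- otherwise. This injects the inversions of `u` into those of `u * σ`, and it misses the new
  -- inversion `(P, Q)`.
  let Φ : Fin n × Fin n → Fin n × Fin n :=
    fun x => if σ x.1 < σ x.2 then (σ x.1, σ x.2) else x
  have hmem : (P, Q) ∈ inversions (u * σ) := by
    rw [mem_inversions]
    simp [hPQ, hP, hQ, hu]
  have hmaps : ∀ x ∈ inversions u, Φ x ∈ (inversions (u * σ)).erase (P, Q) := by
    rintro ⟨p, q⟩ hx
    rw [mem_inversions] at hx
    obtain ⟨hpq, hinv⟩ := hx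
    simp only at hpq hinv
    rw [Finset.mem_erase, mem_inversions]
    simp only [Φ, Equiv.Perm.mul_apply]
    split_ifs with h
    · simp only [hσσ, ne_eq, Prod.mk.injEq, not_and]
      refine ⟨?_, h, hinv⟩
      intro h1 h2
      have e1 : p = Q := by rw [← hσσ p, h1, hP]
      have e2 : q = P := by rw [← hσσ q, h2, hQ]
      subst e1 e2
      exact absurd hpq (not_lt.2 hPQ.le)
    · simp only [ne_eq, Prod.mk.injEq, not_and]
      refine ⟨?_, hpq, ?_⟩
      · rintro rfl rfl
        exact absurd hinv (not_lt.2 hu.le)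
      · by_cases hp : p = P
        · subst hp
          by_cases hq : q = Q
          · subst hq; exact absurd hinv (not_lt.2 hu.le)
          · rw [hP, hr q hpq.ne' hq]
            exact hinv.trans hu
        · by_cases hq : q = Q
          · subst hq
            rw [hQ, hr p hp hpq.ne]
            exact hu.trans hinv
          · by_cases hp' : p = Q
            · subst hp'
              have hq' : q ≠ P := (hPQ.trans hpq).ne'
              rw [hQ, hr q hq' hq] at h
              exact absurd (hPQ.trans hpq) h
            · by_cases hq' : q = P
              · subst hq'
                rw [hP, hr p hp hp'] at h
                exact absurd (hpq.trans hPQ) h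
              · rwa [hr p hp hp', hr q hq' hq]
  have hinj : Set.InjOn Φ (inversions u) := by
    rintro ⟨p, q⟩ hx ⟨p', q'⟩ hy hxy
    rw [Finset.mem_coe, mem_inversions] at hx hy
    simp only [Φ] at hxy
    split_ifs at hxy with h1 h2 h2
    · simpa using hxy
    · simp only [Prod.mk.injEq] at hxy
      rw [← hxy.1, ← hxy.2, hσσ, hσσ] at h2
      exact absurd hx.1 h2
    · simp only [Prod.mk.injEq] at hxy
      rw [hxy.1, hxy.2, hσσ, hσσ] at h1
      exact absurd hy.1 h1
    · exact hxy
  calc (inversions u).card ≤ ((inversions (u * σ)).erase (P, Q)).card :=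
        Finset.card_le_card_of_injOn Φ hmaps hinj
    _ < (inversions (u * σ)).card := Finset.card_erase_lt_of_mem hmem

theorem swap_lt_swap_iff {i j : Fin n} (hij : (i : ℕ) + 1 = j) {x y : Fin n}
    (h₁ : ¬ (x = i ∧ y = j)) (h₂ : ¬ (x = j ∧ y = i)) :
    Equiv.swap i j x < Equiv.swap i j y ↔ x < y := by
  simp only [Equiv.swap_apply_def, Fin.lt_def, Fin.ext_iff] at *
  split_ifs <;> omega

/-- Exchanging consecutive values changes the relative order of that one pair of values only. -/
theorem card_inversions_swap_mul {u : Equiv.Perm (Fin n)} {i j : Fin n} (hij : (i : ℕ) + 1 = j)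
    (hu : u.symm i < u.symm j) :
    (inversions (Equiv.swap i j * u)).card = (inversions u).card + 1 := by
  have hlt : i < j := by rw [Fin.lt_def]; omega
  have : inversions (Equiv.swap i j * u) = insert (u.symm i, u.symm j) (inversions u) := by
    ext ⟨p, q⟩
    simp only [mem_inversions, Equiv.Perm.mul_apply, Finset.mem_insert, Prod.mk.injEq]
    by_cases h1 : u q = i ∧ u p = j
    · obtain ⟨h1, h2⟩ := h1
      have e1 : q = u.symm i := by rw [← h1]; simp
      have e2 : p = u.symm j := by rw [← h2]; simp
      have hqp : q < p := by rw [e1, e2]; exact hu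
      constructor
      · rintro ⟨h, -⟩; exact absurd h (not_lt.2 hqp.le)
      · rintro (⟨h, h'⟩ | ⟨h, -⟩)
        · rw [e2] at h; exact absurd h (by simpa using hlt.ne')
        · exact absurd h (not_lt.2 hqp.le)
    · by_cases h2 : u q = j ∧ u p = i
      · obtain ⟨h2, h3⟩ := h2
        have e1 : q = u.symm j := by rw [← h2]; simp
        have e2 : p = u.symm i := by rw [← h3]; simp
        simp [e1, e2, hu, hlt]
      · rw [swap_lt_swap_iff hij h1 h2]
        constructor
        · exact fun h => Or.inr h
        · rintro (⟨h, h'⟩ | h)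
          · subst h h'; simp at h2
          · exact h
  rw [this, Finset.card_insert_of_notMem]
  simp [mem_inversions, hlt.le]

theorem card_inversions_symm (u : Equiv.Perm (Fin n)) :
    (inversions u⁻¹).card = (inversions u).card := by
  refine Finset.card_bij' (fun x _ => (u⁻¹ x.2, u⁻¹ x.1)) (fun x _ => (u x.2, u x.1)) ?_ ?_ ?_ ?_
  · intro x hx
    rw [mem_inversions] at hx ⊢
    simpa using hx.symm
  · intro x hx
    rw [mem_inversions] at hx ⊢
    simpa using hx.symm
  · intro x _; simp
  · intro x _; simp

theorem card_inversions_mul_swap {u : Equiv.Perm (Fin n)} {P Q : Fin n} (hPQ : (P : ℕ) + 1 = Q)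
    (hu : u P < u Q) : (inversions (u * Equiv.swap P Q)).card = (inversions u).card + 1 := by
  rw [← card_inversions_symm, ← card_inversions_symm u, mul_inv_rev, Equiv.swap_inv]
  exact card_inversions_swap_mul hPQ (by rwa [← Equiv.Perm.inv_def, inv_inv])

theorem card_inversions_swap_mul_le (u : Equiv.Perm (Fin n)) {i j : Fin n}
    (hij : (i : ℕ) + 1 = j) :
    (inversions (Equiv.swap i j * u)).card ≤ (inversions u).card + 1 := by
  rcases lt_trichotomy (u.symm i) (u.symm j) with h | h | h
  · exact (card_inversions_swap_mul hij h).le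
  · have : i = j := u.symm.injective h
    subst this; omega
  · have := card_inversions_swap_mul (u := Equiv.swap i j * u) hij (by
      simpa [Equiv.Perm.mul_def, Equiv.symm_trans_apply] using h)
    rw [Equiv.swap_mul_self_mul] at this
    omega

theorem eq_one_of_strictMono {u : Equiv.Perm (Fin n)} (hu : StrictMono u) : u = 1 := by
  have e := Subsingleton.elim (StrictMono.orderIsoOfSurjective u hu u.surjective)
    (OrderIso.refl (Fin n))
  ext x
  have := congrArg (fun g : Fin n ≃o Fin n => ((g x : Fin n) : ℕ)) e
  simpa using this

/-- A permutation without adjacent values in the wrong order is the identity. -/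
theorem exists_descent_of_ne_one {u : Equiv.Perm (Fin n)} (hu : u ≠ 1) :
    ∃ i j : Fin n, (i : ℕ) + 1 = j ∧ u.symm j < u.symm i := by
  by_contra! hcon
  apply hu
  have hmono : StrictMono u.symm := by
    cases n with
    | zero => exact fun a => a.elim0
    | succ m =>
      rw [Fin.strictMono_iff_lt_succ]
      intro i
      refine lt_of_le_of_ne (hcon _ _ (by simp)) ?_
      simp [Fin.ext_iff]
  have h' : u = (u.symm).symm := (Equiv.symm_symm u).symm
  rw [h', eq_one_of_strictMono hmono]; rfl

/-- Bubble sort: while `u` is not the identity, some consecutive values are in the wrong order, and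
exchanging them removes one inversion. -/
theorem exists_word (u : Equiv.Perm (Fin n)) : ∃ l : List (Equiv.Perm (Fin n)),
    (∀ s ∈ l, IsSimpleTransposition s) ∧ l.prod = u ∧ l.length = (inversions u).card := by
  induction hk : (inversions u).card using Nat.strong_induction_on generalizing u with
  | _ k ih =>
    by_cases hu : u = 1
    · subst hu
      refine ⟨[], by simp, by simp, ?_⟩
      rw [← hk]
      symm
      rw [List.length_nil, Finset.card_eq_zero, Finset.eq_empty_iff_forall_notMem]
      intro x hx
      rw [mem_inversions] at hx
      exact absurd hx.1 (not_lt.2 hx.2.le)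
    · obtain ⟨i, j, hij, h⟩ := exists_descent_of_ne_one hu
      have h1 := card_inversions_swap_mul (u := Equiv.swap i j * u) hij (by
        simpa [Equiv.Perm.mul_def, Equiv.symm_trans_apply] using h)
      rw [Equiv.swap_mul_self_mul] at h1
      obtain ⟨l, hl, hprod, hlen⟩ := ih _ (by omega) (Equiv.swap i j * u) rfl
      refine ⟨Equiv.swap i j :: l, ?_, ?_, ?_⟩
      · intro s hs
        rcases List.mem_cons.1 hs with rfl | hs
        · exact ⟨i, j, hij, rfl⟩
        · exact hl s hs
      · rw [List.prod_cons, hprod, Equiv.swap_mul_self_mul]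
      · rw [List.length_cons, hlen]; omega

theorem permLength_eq_card_inversions (u : Equiv.Perm (Fin n)) :
    permLength u = (inversions u).card := by
  apply le_antisymm
  · exact Nat.sInf_le (exists_word u)
  · obtain ⟨l, hl, hprod, hlen⟩ := Nat.sInf_mem (s := {k | ∃ l : List (Equiv.Perm (Fin n)),
      (∀ s ∈ l, IsSimpleTransposition s) ∧ l.prod = u ∧ l.length = k}) ⟨_, exists_word u⟩
    change (inversions u).card ≤ sInf _
    rw [← hlen, ← hprod]
    clear hlen hprod
    induction l with
    | nil =>
      rw [List.prod_nil, List.length_nil, Nat.le_zero, Finset.card_eq_zero,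
        Finset.eq_empty_iff_forall_notMem]
      intro x hx
      rw [mem_inversions] at hx
      exact absurd hx.1 (not_lt.2 hx.2.le)
    | cons s l ih =>
      obtain ⟨i, j, hij, rfl⟩ := hl s (by simp)
      rw [List.prod_cons, List.length_cons]
      exact (card_inversions_swap_mul_le _ hij).trans
        (Nat.succ_le_succ (ih fun s hs => hl s (by simp [hs])))

end Inversions

/-! ### Bruhat covers and their reversal by the longest permutation. -/

section Covers

variable {n : ℕ}

/-- Rewrites the exchange of values as an exchange of positions. If the smaller value stood to the
right, the exchange would lower the number of inversions instead of raising it. -/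
theorem BruhatCovers.exists_eq_mul_swap {u v : Equiv.Perm (Fin n)} (h : BruhatCovers u v) :
    ∃ P Q : Fin n, P < Q ∧ u P < u Q ∧ v = u * Equiv.swap P Q := by
  obtain ⟨hlen, i, j, hij, rfl⟩ := h
  have hmul : Equiv.swap i j * u = u * Equiv.swap (u.symm i) (u.symm j) := by
    rw [Equiv.mul_swap_eq_swap_mul]; simp
  rcases lt_trichotomy (u.symm i) (u.symm j) with h | h | h
  · exact ⟨_, _, h, by simpa using hij, hmul⟩
  · exact absurd (u.symm.injective h) hij.ne
  · have hlt := card_inversions_lt_mul_swap (u := Equiv.swap i j * u) h (by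
      simpa using hij)
    rw [hmul, Equiv.swap_comm, mul_assoc, Equiv.swap_mul_self, mul_one] at hlt
    rw [permLength_eq_card_inversions, permLength_eq_card_inversions, hmul,
      Equiv.swap_comm] at hlen
    omega

theorem bruhatCovers_swap_mul {u : Equiv.Perm (Fin n)} {i j : Fin n} (hij : (i : ℕ) + 1 = j)
    (hu : u.symm i < u.symm j) : BruhatCovers u (Equiv.swap i j * u) := by
  refine ⟨?_, i, j, by rw [Fin.lt_def]; omega, rfl⟩
  rw [permLength_eq_card_inversions, permLength_eq_card_inversions,
    card_inversions_swap_mul hij hu]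

theorem bruhatCovers_mul_swap {u : Equiv.Perm (Fin n)} {P Q : Fin n} (hPQ : (P : ℕ) + 1 = Q)
    (hu : u P < u Q) : BruhatCovers u (u * Equiv.swap P Q) := by
  refine ⟨?_, u P, u Q, hu, (Equiv.mul_swap_eq_swap_mul u P Q).symm⟩
  rw [permLength_eq_card_inversions, permLength_eq_card_inversions,
    card_inversions_mul_swap hPQ hu]

/-- Reversing all values complements the inversion set, so left multiplication by `longestPerm n`
reverses covers and the Bruhat order. -/
theorem card_inversions_longestPerm_mul (u : Equiv.Perm (Fin n)) :
    (inversions (longestPerm n * u)).card + (inversions u).card =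
      (Finset.univ.filter fun x : Fin n × Fin n => x.1 < x.2).card := by
  rw [← Finset.card_union_of_disjoint]
  · congr 1
    ext x
    simp only [Finset.mem_union, mem_inversions, Finset.mem_filter, Finset.mem_univ, true_and,
      Equiv.Perm.mul_apply, longestPerm, Fin.revPerm_apply, Fin.rev_lt_rev]
    constructor
    · rintro (h | h) <;> exact h.1
    · intro h
      rcases lt_trichotomy (u x.1) (u x.2) with h' | h' | h'
      · exact Or.inl ⟨h, h'⟩
      · exact absurd (u.injective h') h.ne
      · exact Or.inr ⟨h, h'⟩
  · rw [Finset.disjoint_left]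
    intro x hx hy
    rw [mem_inversions] at hx hy
    simp only [Equiv.Perm.mul_apply, longestPerm, Fin.revPerm_apply, Fin.rev_lt_rev] at hx
    exact absurd hx.2 (not_lt.2 hy.2.le)

theorem longestPerm_mul_self : longestPerm n * longestPerm n = 1 := by
  ext x; simp [longestPerm]

theorem BruhatCovers.longestPerm_mul {u v : Equiv.Perm (Fin n)} (h : BruhatCovers u v) :
    BruhatCovers (longestPerm n * v) (longestPerm n * u) := by
  obtain ⟨hlen, i, j, hij, rfl⟩ := h
  refine ⟨?_, Fin.rev j, Fin.rev i, Fin.rev_lt_rev.2 hij, ?_⟩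
  · have h1 := card_inversions_longestPerm_mul u
    have h2 := card_inversions_longestPerm_mul (Equiv.swap i j * u)
    simp only [permLength_eq_card_inversions] at hlen ⊢
    omega
  · ext x
    rw [Equiv.swap_comm]
    have := Equiv.mul_swap_eq_swap_mul (longestPerm n) i j
    have h' : Equiv.swap (Fin.rev i) (Fin.rev j) = longestPerm n * Equiv.swap i j * longestPerm n := by
      rw [this, mul_assoc, longestPerm_mul_self, mul_one]; rfl
    rw [h']
    simp only [longestPerm, Equiv.Perm.mul_apply, Fin.revPerm_apply, Fin.rev_rev,
      Equiv.swap_apply_self]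

theorem BruhatLE.longestPerm_mul {u v : Equiv.Perm (Fin n)} (h : BruhatLE u v) :
    BruhatLE (longestPerm n * v) (longestPerm n * u) := by
  induction h with
  | refl => exact Relation.ReflTransGen.refl
  | tail _ h ih => exact Relation.ReflTransGen.head h.longestPerm_mul ih

theorem bruhatLE_longestPerm_mul_iff {u v : Equiv.Perm (Fin n)} :
    BruhatLE (longestPerm n * v) (longestPerm n * u) ↔ BruhatLE u v := by
  refine ⟨fun h => ?_, BruhatLE.longestPerm_mul⟩
  simpa only [← mul_assoc, longestPerm_mul_self, one_mul] using h.longestPerm_mul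

end Covers

/-! ### Counting elements above a threshold. -/

section CountGE

variable {n : ℕ}

/-- The number of elements of `S` which are at least `t`. -/
def countGE (S : Finset (Fin n)) (t : ℕ) : ℕ :=
  (S.filter fun a : Fin n => t ≤ (a : ℕ)).card

theorem countGE_zero (S : Finset (Fin n)) : countGE S 0 = S.card := by
  simp [countGE]

theorem countGE_of_le (S : Finset (Fin n)) {t : ℕ} (ht : n ≤ t) : countGE S t = 0 := by
  rw [countGE, Finset.card_eq_zero, Finset.filter_eq_empty_iff]
  intro a _
  have := a.isLt
  omega

theorem countGE_eq_succ (S : Finset (Fin n)) (a : Fin n) :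
    countGE S a = countGE S (a + 1) + if a ∈ S then 1 else 0 := by
  unfold countGE
  split_ifs with h
  · rw [← Finset.card_insert_of_notMem (a := a) (s := S.filter fun b : Fin n => (a : ℕ) + 1 ≤ (b : ℕ))
      (by simp)]
    congr 1
    ext b
    simp only [Finset.mem_filter, Finset.mem_insert, Fin.ext_iff]
    constructor
    · rintro ⟨h1, h2⟩
      by_cases hb : (b : ℕ) = a
      · exact Or.inl hb
      · exact Or.inr ⟨h1, by omega⟩
    · rintro (h1 | ⟨h1, h2⟩)
      · have : b = a := Fin.ext h1
        subst this; exact ⟨h, le_rfl⟩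
      · exact ⟨h1, by omega⟩
  · rw [add_zero]
    congr 1
    ext b
    simp only [Finset.mem_filter, and_congr_right_iff]
    intro hb
    have : (b : ℕ) ≠ a := fun h' => h (by rwa [← Fin.ext h'])
    omega

theorem countGE_anti (S : Finset (Fin n)) {s t : ℕ} (h : s ≤ t) : countGE S t ≤ countGE S s :=
  Finset.card_le_card (Finset.monotone_filter_right _ fun _ _ h' => h.trans h')

theorem countGE_image (z : Equiv.Perm (Fin n)) (J : Finset (Fin n)) (t : ℕ) :
    countGE (J.image z) t = (J.filter fun p => t ≤ (z p : ℕ)).card := by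
  rw [countGE, Finset.filter_image, Finset.card_image_of_injective _ z.injective]

theorem countGE_compl_add (S : Finset (Fin n)) (t : ℕ) :
    countGE Sᶜ t + countGE S t = countGE (Finset.univ : Finset (Fin n)) t := by
  unfold countGE
  rw [← Finset.card_union_of_disjoint]
  · congr 1
    ext a
    simp only [Finset.mem_union, Finset.mem_filter, Finset.mem_compl, Finset.mem_univ, true_and]
    tauto
  · rw [Finset.disjoint_left]
    intro a ha hb
    simp only [Finset.mem_filter, Finset.mem_compl] at ha hb
    exact ha.1 hb.1

theorem image_compl_perm (z : Equiv.Perm (Fin n)) (J : Finset (Fin n)) :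
    Jᶜ.image z = (J.image z)ᶜ := by
  ext a
  simp [Finset.mem_image, ← Equiv.eq_symm_apply]

/-- The number of elements at least `t` of the reversal of `S`. -/
theorem countGE_image_rev (S : Finset (Fin n)) {t : ℕ} (ht : t ≤ n) :
    countGE (S.image Fin.rev) t + countGE S (n - t) = S.card := by
  unfold countGE
  rw [Finset.filter_image, Finset.card_image_of_injective _ Fin.rev_injective,
    ← Finset.card_filter_add_card_filter_not (s := S) (fun a => t ≤ ((Fin.rev a : Fin n) : ℕ))]
  congr 2
  ext a
  simp only [Finset.mem_filter, Fin.val_rev, and_congr_right_iff]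
  intro _
  have := a.isLt
  omega

end CountGE

/-! ### Gale domination of a prefix as a Bruhat interval. -/

section Dominated

variable {n : ℕ}

/-- The permutations which map the set `J` of positions to a set of values below `A`. -/
def dominated (J A : Finset (Fin n)) : Set (Equiv.Perm (Fin n)) :=
  {z | ∀ t, countGE (J.image z) t ≤ countGE A t}

/-- The first `j` positions. -/
def initialPositions (n j : ℕ) : Finset (Fin n) :=
  Finset.univ.filter fun p => (p : ℕ) < j

theorem mem_initialPositions {j : ℕ} {p : Fin n} : p ∈ initialPositions n j ↔ (p : ℕ) < j := by
  simp [initialPositions]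

theorem card_initialPositions {j : ℕ} (hj : j ≤ n) : (initialPositions n j).card = j := by
  have := Fin.card_filter_val_lt (n := n) (m := j)
  rw [initialPositions]
  simpa [hj] using this

/-- The easy half of the tableau criterion. If `Q` is in the prefix, so is `P`, and the set of
values there is unchanged; otherwise at most one value in the prefix changes, and it grows. -/
theorem BruhatCovers.countGE_le {u v : Equiv.Perm (Fin n)} (h : BruhatCovers u v) (j t : ℕ) :
    countGE ((initialPositions n j).image u) t ≤ countGE ((initialPositions n j).image v) t := by
  obtain ⟨P, Q, hPQ, hu, rfl⟩ := h.exists_eq_mul_swap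
  rw [countGE_image, countGE_image]
  rw [Fin.lt_def] at hPQ hu
  by_cases hQ : Q ∈ initialPositions n j
  · have hP : P ∈ initialPositions n j := by
      rw [mem_initialPositions] at *; omega
    apply le_of_eq
    refine Finset.card_bij' (fun p _ => Equiv.swap P Q p) (fun p _ => Equiv.swap P Q p) ?_ ?_ ?_ ?_
    · intro p hp
      rw [Finset.mem_filter] at hp ⊢
      refine ⟨?_, by simpa using hp.2⟩
      rw [Equiv.swap_apply_def]; split_ifs <;> [exact hQ; exact hP; exact hp.1]
    · intro p hp
      rw [Finset.mem_filter] at hp ⊢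
      refine ⟨?_, by simpa using hp.2⟩
      rw [Equiv.swap_apply_def]; split_ifs <;> [exact hQ; exact hP; exact hp.1]
    · intro p _; simp
    · intro p _; simp
  · apply Finset.card_le_card
    intro p hp
    rw [Finset.mem_filter] at hp ⊢
    refine ⟨hp.1, hp.2.trans ?_⟩
    have hpQ : p ≠ Q := fun h => hQ (h ▸ hp.1)
    rw [Equiv.Perm.mul_apply]
    by_cases hpP : p = P
    · subst hpP; rw [Equiv.swap_apply_left]; omega
    · rw [Equiv.swap_apply_of_ne_of_ne hpP hpQ]

theorem BruhatLE.countGE_le {u v : Equiv.Perm (Fin n)} (h : BruhatLE u v) (j t : ℕ) :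
    countGE ((initialPositions n j).image u) t ≤ countGE ((initialPositions n j).image v) t := by
  induction h with
  | refl => exact le_rfl
  | tail _ h ih => exact ih.trans (h.countGE_le j t)

theorem ofOneLine_apply {l : List (Fin n)} (hn : l.Nodup) (hm : ∀ x, x ∈ l) (p : Fin n)
    (hp : (p : ℕ) < l.length) : ofOneLine l hn hm p = l[(p : ℕ)] := rfl

theorem length_oneLine {l : List (Fin n)} (hn : l.Nodup) (hm : ∀ x, x ∈ l) : l.length = n := by
  simpa using Fintype.card_congr (hn.getEquivOfForallMemList l hm)

theorem length_decSeq (A : Finset (Fin n)) : (decSeq A).length = A.card := by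
  simp [decSeq]

theorem image_decThenOmega (A : Finset (Fin n)) :
    (initialPositions n A.card).image (decThenOmega A) = A := by
  have hA : A.card ≤ n := by simpa using A.card_le_univ
  apply Finset.eq_of_subset_of_card_le
  · intro a ha
    obtain ⟨p, hp, rfl⟩ := Finset.mem_image.1 ha
    rw [mem_initialPositions] at hp
    have hlen : (p : ℕ) < (decSeq A ++ omegaDel A).length := by
      rw [List.length_append, length_decSeq]; omega
    rw [decThenOmega, ofOneLine_apply _ _ p hlen,
      List.getElem_append_left (by rwa [length_decSeq])]
    have : (decSeq A)[(p : ℕ)]'(by rwa [length_decSeq]) ∈ decSeq A := List.getElem_mem _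
    exact (Finset.mem_sort _).1 this
  · rw [Finset.card_image_of_injective _ (Equiv.injective _), card_initialPositions hA]

theorem decThenOmega_lt {A : Finset (Fin n)} {p q : Fin n} (hpq : p < q)
    (h : (q : ℕ) < A.card ∨ A.card ≤ (p : ℕ)) : decThenOmega A q < decThenOmega A p := by
  rw [Fin.lt_def] at hpq
  have hlen : (decSeq A ++ omegaDel A).length = n := by
    refine length_oneLine ?_ ?_
    · refine List.Nodup.append (Finset.sort_nodup _ _)
        ((List.nodup_reverse.2 (List.nodup_finRange n)).filter _) ?_
      intro x hx hy
      simp_all [decSeq, omegaDel]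
    · intro x; by_cases h : x ∈ A <;> simp [decSeq, omegaDel, h]
  rw [decThenOmega, ofOneLine_apply _ _ p (by omega), ofOneLine_apply _ _ q (by omega)]
  have hl := length_decSeq A
  rcases h with h | h
  · rw [List.getElem_append_left (by omega), List.getElem_append_left (by omega)]
    have hs : (decSeq A).Pairwise (· > ·) := Finset.sortedGT_sort A |>.pairwise
    exact List.pairwise_iff_getElem.1 hs _ _ _ _ hpq
  · rw [List.getElem_append_right (by omega), List.getElem_append_right (by omega)]
    have hs : (omegaDel A).Pairwise (· > ·) := by
      refine List.Pairwise.filter _ ?_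
      rw [List.pairwise_reverse]
      exact List.pairwise_lt_finRange n
    refine List.pairwise_iff_getElem.1 hs _ _ _ _ ?_
    omega

/-- A permutation which decreases on the first `j` and on the remaining positions is
determined by its values on the first `j` positions. -/
theorem eq_of_image_eq_of_antitone {j : ℕ} {z v : Equiv.Perm (Fin n)}
    (him : (initialPositions n j).image z = (initialPositions n j).image v)
    (hz : ∀ p q : Fin n, p < q → ((q : ℕ) < j ∨ j ≤ (p : ℕ)) → z q < z p)
    (hv : ∀ p q : Fin n, p < q → ((q : ℕ) < j ∨ j ≤ (p : ℕ)) → v q < v p) : z = v := by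
  have hiff : ∀ p : Fin n, ((v.symm (z p) : Fin n) : ℕ) < j ↔ (p : ℕ) < j := by
    intro p
    rw [← mem_initialPositions, ← mem_initialPositions,
      ← v.injective.mem_finset_image, ← him, Equiv.apply_symm_apply,
      z.injective.mem_finset_image]
  -- Within a block both permutations decrease, so the composite increases; by `hiff` it maps each
  -- block to itself. A strictly increasing permutation is the identity.
  have hmono : StrictMono (v⁻¹ * z : Equiv.Perm (Fin n)) := by
    intro p q hpq
    change v.symm (z p) < v.symm (z q)
    have hp := hiff p
    have hq := hiff q
    by_cases h : (q : ℕ) < j ∨ j ≤ (p : ℕ)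
    · have h1 := hz p q hpq h
      by_contra hcon
      rcases (not_lt.1 hcon).lt_or_eq with h2 | h2
      · have h3 := hv _ _ h2 (by omega)
        simp only [Equiv.apply_symm_apply] at h3
        exact absurd h1 (not_lt.2 h3.le)
      · have := v.symm.injective h2
        rw [this] at h1
        exact lt_irrefl _ h1
    · rw [Fin.lt_def]; omega
  have := eq_one_of_strictMono hmono
  rw [inv_mul_eq_one] at this
  exact this.symm

theorem antitone_of_adjacent {j : ℕ} {z : Equiv.Perm (Fin n)}
    (h : ∀ p q : Fin n, (p : ℕ) + 1 = q → ((q : ℕ) < j ∨ j ≤ (p : ℕ)) → ¬ z p < z q)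
    (p q : Fin n) (hpq : p < q) (hj : (q : ℕ) < j ∨ j ≤ (p : ℕ)) : z q < z p := by
  obtain ⟨d, hd⟩ : ∃ d, (q : ℕ) = p + 1 + d := ⟨q - (p + 1), by rw [Fin.lt_def] at hpq; omega⟩
  induction d generalizing q with
  | zero =>
    refine lt_of_le_of_ne (not_lt.1 (h p q (by omega) hj)) ?_
    intro h'
    exact hpq.ne' (z.injective h')
  | succ d ih =>
    have hq := q.isLt
    let r : Fin n := ⟨p + 1 + d, by omega⟩
    have hr : (r : ℕ) = p + 1 + d := rfl
    have h1 := ih r (by rw [Fin.lt_def]; omega) (by omega) hr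
    exact (not_lt.1 (h r q (by omega) (by omega))).trans_lt h1

/-- If `S` is strictly below `A`, some element of `S` can be raised by one. -/
theorem exists_raise {S A : Finset (Fin n)} (hcard : S.card = A.card)
    (h : ∀ t, countGE S t ≤ countGE A t) (hne : S ≠ A) :
    ∃ i j : Fin n, (i : ℕ) + 1 = j ∧ i ∈ S ∧ j ∉ S ∧ countGE S j < countGE A j := by
  classical
  -- If there were no such element, all counts would agree by induction on the threshold, and then
  -- `S = A`.
  have hT : (Finset.univ.filter fun i : Fin n =>
      i ∈ S ∧ countGE S (i + 1) < countGE A (i + 1)).Nonempty := by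
    by_contra hempty
    rw [Finset.not_nonempty_iff_eq_empty, Finset.filter_eq_empty_iff] at hempty
    have heq : ∀ t, countGE S t = countGE A t := by
      intro t
      induction t with
      | zero => rw [countGE_zero, countGE_zero, hcard]
      | succ t ih =>
        by_cases ht : t < n
        · have e1 := countGE_eq_succ S ⟨t, ht⟩
          have e2 := countGE_eq_succ A ⟨t, ht⟩
          have e3 := hempty (Finset.mem_univ ⟨t, ht⟩)
          have e4 := h (t + 1)
          simp only [not_and] at e1 e2 e3
          by_cases hS : (⟨t, ht⟩ : Fin n) ∈ S
          · have := e3 hS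
            omega
          · rw [if_neg hS] at e1
            split_ifs at e2 <;> omega
        · rw [countGE_of_le _ (by omega), countGE_of_le _ (by omega)]
    apply hne
    ext a
    have e1 := countGE_eq_succ S a
    have e2 := countGE_eq_succ A a
    have e3 := heq a
    have e4 := heq (a + 1)
    split_ifs at e1 e2 <;> simp_all
  -- For the largest such `i`, the element `i + 1` is not in `S`: otherwise the strict inequality
  -- would persist one threshold higher, contradicting maximality.
  set i := Finset.max' _ hT with hi
  have hiT := Finset.max'_mem _ hT
  rw [← hi, Finset.mem_filter] at hiT
  obtain ⟨-, hiS, hlt⟩ := hiT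
  have hin : (i : ℕ) + 1 < n := by
    by_contra hge
    rw [countGE_of_le A (by omega)] at hlt
    omega
  refine ⟨i, ⟨i + 1, hin⟩, rfl, hiS, ?_, hlt⟩
  intro hjS
  have e1 := countGE_eq_succ S ⟨i + 1, hin⟩
  have e2 := countGE_eq_succ A ⟨i + 1, hin⟩
  rw [if_pos hjS] at e1
  have hmax := Finset.le_max' (Finset.univ.filter fun i : Fin n =>
      i ∈ S ∧ countGE S (i + 1) < countGE A (i + 1)) ⟨i + 1, hin⟩ (by
    rw [Finset.mem_filter]
    refine ⟨Finset.mem_univ _, hjS, ?_⟩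
    simp only at e1 e2 ⊢
    split_ifs at e2 <;> omega)
  rw [← hi, Fin.le_def] at hmax
  simp at hmax

/-- Climb from `z` by covers that preserve domination. An ascent inside a block is swapped. Once
both blocks decrease, either the prefix holds exactly `A` and `z` is the target, or `exists_raise`
provides a value of the prefix to exchange with its successor. The number of inversions grows, so
the climb ends. -/
theorem bruhatLE_decThenOmega {A : Finset (Fin n)} {z : Equiv.Perm (Fin n)}
    (hz : z ∈ dominated (initialPositions n A.card) A) : BruhatLE z (decThenOmega A) := by
  have hA : A.card ≤ n := by simpa using A.card_le_univ
  induction hk : (Finset.univ : Finset (Fin n × Fin n)).card - (inversions z).card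
    using Nat.strong_induction_on generalizing z with
  | _ k ih =>
  have step : ∀ w : Equiv.Perm (Fin n), w ∈ dominated (initialPositions n A.card) A →
      BruhatCovers z w → BruhatLE z (decThenOmega A) := by
    intro w hw hcov
    refine Relation.ReflTransGen.head hcov (ih _ ?_ hw rfl)
    have h1 := hcov.1
    rw [permLength_eq_card_inversions, permLength_eq_card_inversions] at h1
    have h2 := Finset.card_le_univ (inversions w)
    rw [← Finset.card_univ] at h2
    omega
  by_cases hasc : ∃ p q : Fin n, (p : ℕ) + 1 = q ∧ ((q : ℕ) < A.card ∨ A.card ≤ (p : ℕ)) ∧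
      z p < z q
  · obtain ⟨p, q, hpq, hj, hlt⟩ := hasc
    refine step _ ?_ (bruhatCovers_mul_swap hpq hlt)
    have him : (initialPositions n A.card).image (z * Equiv.swap p q)
        = (initialPositions n A.card).image z := by
      have hswap : ∀ x, x ∈ initialPositions n A.card →
          Equiv.swap p q x ∈ initialPositions n A.card := by
        intro x hx
        rw [mem_initialPositions] at *
        rw [Equiv.swap_apply_def]
        split_ifs with h1 h2
        · subst h1; omega
        · subst h2; omega
        · exact hx
      ext a
      simp only [Finset.mem_image, Equiv.Perm.mul_apply]
      constructor
      · rintro ⟨x, hx, rfl⟩; exact ⟨_, hswap x hx, rfl⟩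
      · rintro ⟨x, hx, rfl⟩; exact ⟨_, hswap x hx, by simp⟩
    intro t
    rw [him]
    exact hz t
  · have hanti := antitone_of_adjacent (j := A.card) (z := z) (fun p q hpq hj hlt =>
      hasc ⟨p, q, hpq, hj, hlt⟩)
    by_cases him : (initialPositions n A.card).image z = A
    · have : z = decThenOmega A := by
        refine eq_of_image_eq_of_antitone (j := A.card) ?_ hanti fun p q => decThenOmega_lt
        rw [him, image_decThenOmega]
      rw [this]
      exact Relation.ReflTransGen.refl
    · obtain ⟨i, j, hij, hi, hj, hlt⟩ := exists_raise (by
        rw [Finset.card_image_of_injective _ z.injective, card_initialPositions hA]) hz him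
      have hi' : ((z.symm i : Fin n) : ℕ) < A.card := by
        rw [← mem_initialPositions, ← z.injective.mem_finset_image]; simpa using hi
      have hj' : ¬ ((z.symm j : Fin n) : ℕ) < A.card := by
        rw [← mem_initialPositions, ← z.injective.mem_finset_image]; simpa using hj
      refine step _ ?_ (bruhatCovers_swap_mul hij (by rw [Fin.lt_def]; omega))
      intro t
      -- The exchange raises the count at the threshold `j` only, by one, and there `hlt` leaves
      -- room.
      by_cases ht : t = j
      · subst ht
        refine le_trans ?_ hlt
        rw [countGE_image, countGE_image]
        rw [Nat.succ_eq_add_one, ← Finset.card_insert_of_notMem (a := z.symm i)]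
        · apply Finset.card_le_card
          intro p hp
          rw [Finset.mem_filter, Equiv.Perm.mul_apply] at hp
          rw [Finset.mem_insert, Finset.mem_filter]
          by_cases hpi : z p = i
          · left; rw [← hpi]; simp
          · right
            refine ⟨hp.1, ?_⟩
            by_cases hpj : z p = j
            · rw [hpj]
            · rw [Equiv.swap_apply_of_ne_of_ne hpi hpj] at hp
              exact hp.2
        · simp; omega
      · refine le_trans (Finset.card_le_card_of_injOn (Equiv.swap i j) ?_
          (Equiv.injective _).injOn) (hz t)
        intro a ha
        rw [Finset.mem_coe, Finset.mem_filter, Finset.mem_image] at ha ⊢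
        obtain ⟨⟨p, hp, rfl⟩, h⟩ := ha
        refine ⟨⟨p, hp, by simp⟩, ?_⟩
        rw [Equiv.swap_apply_def]
        rw [Equiv.Perm.mul_apply] at *
        split_ifs with h1 h2
        · rw [h1] at h; omega
        · rw [h2] at h; omega
        · exact h

theorem bruhatLE_decThenOmega_iff {A : Finset (Fin n)} {z : Equiv.Perm (Fin n)} :
    BruhatLE z (decThenOmega A) ↔ z ∈ dominated (initialPositions n A.card) A := by
  refine ⟨fun h t => ?_, bruhatLE_decThenOmega⟩
  have := h.countGE_le A.card t
  rwa [image_decThenOmega] at this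

/-- This is the case `A = ∅`, where domination of the empty prefix is vacuous. -/
theorem bruhatLE_longestPerm (z : Equiv.Perm (Fin n)) : BruhatLE z (longestPerm n) := by
  have h : decThenOmega (∅ : Finset (Fin n)) = longestPerm n := by
    refine eq_of_image_eq_of_antitone (j := 0) (by simp [initialPositions]) ?_ ?_
    · exact fun p q hpq _ => decThenOmega_lt hpq (by simp)
    · intro p q hpq _
      simp [longestPerm, hpq]
  rw [← h]
  apply bruhatLE_decThenOmega
  intro t
  simp [initialPositions]

theorem one_bruhatLE (z : Equiv.Perm (Fin n)) : BruhatLE 1 z := by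
  rw [← bruhatLE_longestPerm_mul_iff, mul_one]
  exact bruhatLE_longestPerm _

theorem incSeq_eq_filter (A : Finset (Fin n)) :
    incSeq A = (List.finRange n).filter (· ∈ A) := by
  refine List.Perm.eq_of_pairwise (le := (· ≤ ·)) (fun a b _ _ => le_antisymm)
    (Finset.pairwise_sort _ _) ?_ ?_
  · exact ((List.pairwise_lt_finRange n).imp le_of_lt).filter _
  · rw [incSeq, List.perm_ext_iff_of_nodup (Finset.sort_nodup _ _) ((List.nodup_finRange n).filter _)]
    simp

theorem decSeq_eq_filter (A : Finset (Fin n)) :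
    decSeq A = (List.finRange n).reverse.filter (· ∈ A) := by
  refine List.Perm.eq_of_pairwise (le := (· ≥ ·)) (fun a b _ _ h h' => le_antisymm h' h)
    (Finset.pairwise_sort _ _) ?_ ?_
  · refine List.Pairwise.filter _ ?_
    rw [List.pairwise_reverse]
    exact (List.pairwise_lt_finRange n).imp le_of_lt
  · rw [decSeq, List.perm_ext_iff_of_nodup (Finset.sort_nodup _ _)
      ((List.nodup_reverse.2 (List.nodup_finRange n)).filter _)]
    simp

theorem eThenInc_eq (A : Finset (Fin n)) : eThenInc A = incThenE Aᶜ := by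
  have h : eDel A ++ incSeq A = incSeq Aᶜ ++ eDel Aᶜ := by
    simp [incSeq_eq_filter, eDel]
  unfold eThenInc incThenE
  congr 1

theorem omegaThenDec_eq (A : Finset (Fin n)) : omegaThenDec A = decThenOmega Aᶜ := by
  have h : omegaDel A ++ decSeq A = decSeq Aᶜ ++ omegaDel Aᶜ := by
    simp [decSeq_eq_filter, omegaDel]
  unfold omegaThenDec decThenOmega
  congr 1

theorem incThenE_eq (A : Finset (Fin n)) :
    incThenE A = longestPerm n * decThenOmega (A.image Fin.rev) := by
  have h : incSeq A ++ eDel A =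
      (decSeq (A.image Fin.rev) ++ omegaDel (A.image Fin.rev)).map Fin.rev := by
    have hmem : ∀ a : Fin n, a.rev ∈ A.image Fin.rev ↔ a ∈ A := fun a =>
      Fin.rev_injective.mem_finset_image
    rw [incSeq_eq_filter, decSeq_eq_filter, eDel, omegaDel, List.finRange_reverse]
    simp only [List.map_append, List.filter_map, List.map_map, Function.comp_def, hmem,
      Fin.rev_rev, List.map_id']
  ext p
  have hlen : (incSeq A ++ eDel A).length = n :=
    length_oneLine (List.Nodup.append (Finset.sort_nodup _ _)
      ((List.nodup_finRange n).filter _) (by intro x hx hy; simp_all [incSeq, eDel]))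
      (by intro x; by_cases h : x ∈ A <;> simp [incSeq, eDel, h])
  have hlen' := congrArg List.length h
  rw [List.length_map] at hlen'
  rw [incThenE, ofOneLine_apply _ _ p (by omega), Equiv.Perm.mul_apply, decThenOmega,
    ofOneLine_apply _ _ p (by omega), longestPerm, Fin.revPerm_apply, ← List.getElem_map Fin.rev]
  · simp only [h]
  · rw [List.length_map]; omega

/-- Reversing values turns this into the statement for `decThenOmega`. The reversed Gale inequality
on the prefix is then read as domination of the complementary positions by `Aᶜ`, so that both cells
have the form `dominated`. -/
theorem incThenE_bruhatLE_iff {A : Finset (Fin n)} {z : Equiv.Perm (Fin n)} :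
    BruhatLE (incThenE A) z ↔ z ∈ dominated (initialPositions n A.card)ᶜ Aᶜ := by
  have hA : A.card ≤ n := by simpa using A.card_le_univ
  rw [← bruhatLE_longestPerm_mul_iff, incThenE_eq, ← mul_assoc, longestPerm_mul_self, one_mul,
    bruhatLE_decThenOmega_iff, Finset.card_image_of_injective _ Fin.rev_injective]
  set J := initialPositions n A.card with hJ
  have hcard : (J.image z).card = A.card := by
    rw [Finset.card_image_of_injective _ z.injective, hJ, card_initialPositions hA]
  have him : J.image (longestPerm n * z) = (J.image z).image Fin.rev := by
    rw [Finset.image_image]; rfl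
  have h1 : ∀ t, countGE (J.image z)ᶜ t ≤ countGE Aᶜ t ↔ countGE A t ≤ countGE (J.image z) t := by
    intro t
    have e1 := countGE_compl_add (J.image z) t
    have e2 := countGE_compl_add A t
    omega
  simp only [dominated, Set.mem_ofPred_eq, him, image_compl_perm, h1]
  constructor
  · intro h t
    rcases le_or_gt t n with ht | ht
    · have e1 := countGE_image_rev (J.image z) (Nat.sub_le n t)
      have e2 := countGE_image_rev A (Nat.sub_le n t)
      rw [Nat.sub_sub_self ht] at e1 e2
      have := h (n - t)
      omega
    · rw [countGE_of_le A ht.le]; exact Nat.zero_le _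
  · intro h t
    rcases le_or_gt t n with ht | ht
    · have e1 := countGE_image_rev (J.image z) ht
      have e2 := countGE_image_rev A ht
      have := h (n - t)
      omega
    · rw [countGE_of_le _ ht.le]; exact Nat.zero_le _

end Dominated

/-! ### Linear optimization on a half-space section of the permutahedron. -/

section SortedWeights

variable {n : ℕ}

/-- The linear form `∑ i ∈ J, x_i`. -/
def coordSum (J : Finset (Fin n)) : (Fin n → ℝ) →ₗ[ℝ] ℝ :=
  ∑ i ∈ J, LinearMap.proj i

theorem coordSum_apply (J : Finset (Fin n)) (x : Fin n → ℝ) : coordSum J x = ∑ i ∈ J, x i := by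
  simp [coordSum]

/-- The sum of the elements of `A ⊆ {0, …, n - 1}`. -/
def valueSum (A : Finset (Fin n)) : ℕ := ∑ a ∈ A, (a : ℕ)

theorem valueSum_image (z : Equiv.Perm (Fin n)) (J : Finset (Fin n)) :
    valueSum (J.image z) = ∑ p ∈ J, (z p : ℕ) :=
  Finset.sum_image fun _ _ _ _ h => z.injective h

theorem coordSum_permPoint (J : Finset (Fin n)) (z : Equiv.Perm (Fin n)) :
    coordSum J (permPoint z) = (valueSum (J.image z) : ℝ) + J.card := by
  rw [coordSum_apply, valueSum_image]
  simp [permPoint, Finset.sum_add_distrib]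

theorem monotone_of_adjacent {f : Fin n → ℝ} (h : ∀ i j : Fin n, (i : ℕ) + 1 = j → f i ≤ f j) :
    Monotone f := by
  cases n with
  | zero => exact fun a => a.elim0
  | succ m =>
    rw [Fin.monotone_iff_le_succ]
    exact fun i => h _ _ (by simp)

/-- The rearrangement inequality on the vertices of the permutahedron. -/
theorem sum_mul_permPoint_le {w : Fin n → ℝ} {z : Equiv.Perm (Fin n)}
    (hz : Monotone fun k => w (z.symm k)) (z' : Equiv.Perm (Fin n)) :
    ∑ i, w i * permPoint z' i ≤ ∑ i, w i * permPoint z i := by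
  have hmono : Monovary w (permPoint z) := by
    intro i j hij
    have : z i ≤ z j := by
      simp only [permPoint, add_lt_add_iff_right, Nat.cast_lt] at hij
      exact hij.le
    simpa using hz this
  have := hmono.sum_mul_comp_perm_le_sum_mul (σ := z⁻¹ * z')
  refine le_trans (le_of_eq ?_) this
  refine Finset.sum_congr rfl fun i _ => ?_
  simp [permPoint]

theorem sum_mul_le_of_mem_permutahedron {w : Fin n → ℝ} {z : Equiv.Perm (Fin n)}
    (hz : Monotone fun k => w (z.symm k)) {x : Fin n → ℝ} (hx : x ∈ permutahedron n) :
    ∑ i, w i * x i ≤ ∑ i, w i * permPoint z i := by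
  have hsub : permutahedron n ⊆ {x | ∑ i, w i * x i ≤ ∑ i, w i * permPoint z i} := by
    refine convexHull_min ?_ ?_
    · rintro _ ⟨z', rfl⟩
      exact sum_mul_permPoint_le hz z'
    · refine convex_halfSpace_le (f := fun x : Fin n → ℝ => ∑ i, w i * x i) ⟨?_, ?_⟩ _
      · intro x y; simp [mul_add, Finset.sum_add_distrib]
      · intro c x; simp [Finset.mul_sum, mul_left_comm]
  exact hsub hx

theorem exists_sorting_perm (w : Fin n → ℝ) :
    ∃ z : Equiv.Perm (Fin n), Monotone fun k => w (z.symm k) :=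
  ⟨(Tuple.sort w).symm, Tuple.monotone_sort w⟩

theorem exists_adjacent_of_notMem_of_mem {S : Finset (Fin n)} {x y : Fin n} (hxy : x < y)
    (hx : x ∉ S) (hy : y ∈ S) : ∃ i j : Fin n, (i : ℕ) + 1 = j ∧ i ∉ S ∧ j ∈ S := by
  by_contra! hcon
  obtain ⟨d, hd⟩ : ∃ d, (y : ℕ) = x + d := ⟨y - x, by rw [Fin.lt_def] at hxy; omega⟩
  clear hxy
  induction d generalizing y with
  | zero =>
    have : y = x := Fin.ext hd
    exact hx (this ▸ hy)
  | succ d ih =>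
    have hlt := y.isLt
    refine ih (y := ⟨x + d, by omega⟩) ?_ rfl
    by_contra h
    exact hcon _ y (by simp only; omega) h hy

/-- If no element of `S` could be lowered by one, `S` would be closed downwards. All of `S \ A`
would then lie below all of `A \ S`, and the sum of `S` could not be larger. -/
theorem exists_adjacent_of_valueSum_lt {S A : Finset (Fin n)} (hcard : S.card = A.card)
    (hlt : valueSum A < valueSum S) : ∃ i j : Fin n, (i : ℕ) + 1 = j ∧ i ∉ S ∧ j ∈ S := by
  by_contra hcon
  have hle : ∀ x ∈ S \ A, ∀ y ∈ A \ S, x ≤ y := by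
    intro x hx y hy
    rw [Finset.mem_sdiff] at hx hy
    by_contra h
    exact hcon (exists_adjacent_of_notMem_of_mem (not_le.1 h) hy.2 hx.1)
  have hc : (S \ A).card = (A \ S).card := Finset.card_sdiff_comm hcard
  have h1 : ∑ a ∈ S \ A, (a : ℕ) ≤ ∑ a ∈ A \ S, (a : ℕ) := by
    rcases (S \ A).eq_empty_or_nonempty with h | h
    · simp [h]
    · calc ∑ a ∈ S \ A, (a : ℕ) ≤ (S \ A).card • ((S \ A).max' h : ℕ) :=
            Finset.sum_le_card_nsmul _ _ _ fun x hx => Finset.le_max' _ _ hx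
        _ = (A \ S).card • ((S \ A).max' h : ℕ) := by rw [hc]
        _ ≤ ∑ a ∈ A \ S, (a : ℕ) :=
            Finset.card_nsmul_le_sum _ _ _ fun y hy => hle _ (Finset.max'_mem _ h) y hy
  have h2 := Finset.sum_inter_add_sum_sdiff S A fun a => (a : ℕ)
  have h3 := Finset.sum_inter_add_sum_sdiff A S fun a => (a : ℕ)
  rw [Finset.inter_comm] at h3
  unfold valueSum at hlt
  omega

/-- The weights `w`, lowered by `l` on `J`. -/
def loweredWeight (w : Fin n → ℝ) (J : Finset (Fin n)) (l : ℝ) (i : Fin n) : ℝ :=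
  w i - if i ∈ J then l else 0

/-- Increase `l` until the first tie between consecutive values, the lower outside `J` and the
higher in `J`. At the tie both orders are sorted, so the two values can be exchanged, and the sum on
`J` drops by one. -/
theorem exists_lowered_sorted_step {w : Fin n → ℝ} {J : Finset (Fin n)} {l : ℝ}
    {z : Equiv.Perm (Fin n)} (hz : Monotone fun k => loweredWeight w J l (z.symm k)) {m : ℕ}
    (hsum : valueSum (J.image z) = m + 1)
    (hadj : ∃ i j : Fin n, (i : ℕ) + 1 = j ∧ i ∉ J.image z ∧ j ∈ J.image z) :
    ∃ (z' : Equiv.Perm (Fin n)) (l' : ℝ), l ≤ l' ∧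
      (Monotone fun k => loweredWeight w J l' (z'.symm k)) ∧ valueSum (J.image z') = m := by
  classical
  have himg : ∀ k, k ∈ J.image z ↔ z.symm k ∈ J := by
    intro k; rw [← z.injective.mem_finset_image (s := J), Equiv.apply_symm_apply]
  simp only [himg] at hadj
  let T : Finset (Fin n × Fin n) := Finset.univ.filter fun x =>
    (x.1 : ℕ) + 1 = x.2 ∧ z.symm x.1 ∉ J ∧ z.symm x.2 ∈ J
  have hT : T.Nonempty := by
    obtain ⟨i, j, h⟩ := hadj
    exact ⟨(i, j), by simpa [T] using h⟩
  -- The least gap is the multiplier of the first tie. Up to it no other adjacent pair gets out of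
  -- order, because gaps from `J` to its complement only widen.
  obtain ⟨⟨i, j⟩, hij, hmin⟩ := T.exists_min_image (fun x => w (z.symm x.2) - w (z.symm x.1)) hT
  simp only [T, Finset.mem_filter, Finset.mem_univ, true_and, and_imp, Prod.forall] at hij hmin
  obtain ⟨hadj, hi, hj⟩ := hij
  have hlt : i < j := by rw [Fin.lt_def]; omega
  set l' := w (z.symm j) - w (z.symm i) with hl'
  have hll' : l ≤ l' := by
    have := hz hlt.le
    simp only [loweredWeight, hi, hj, if_true, if_false] at this
    linarith
  have hsorted : Monotone fun k => loweredWeight w J l' (z.symm k) := by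
    refine monotone_of_adjacent fun a b hab => ?_
    have h1 := hz (show a ≤ b by rw [Fin.le_def]; omega)
    have h2 := hmin a b hab
    simp only [loweredWeight] at h1 ⊢
    by_cases ha : z.symm a ∈ J <;> by_cases hb : z.symm b ∈ J <;>
      simp only [ha, hb, if_true, if_false, not_true, not_false_eq_true, forall_true_left]
        at h1 h2 ⊢ <;> linarith
  have heq : loweredWeight w J l' (z.symm i) = loweredWeight w J l' (z.symm j) := by
    simp only [loweredWeight, hi, hj, if_true, if_false]
    linarith
  refine ⟨Equiv.swap i j * z, l', hll', ?_, ?_⟩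
  · convert hsorted using 2 with k
    have : (Equiv.swap i j * z).symm k = z.symm (Equiv.swap i j k) := rfl
    rw [this, Equiv.swap_apply_def]
    split_ifs with h1 h2
    · rw [h1, heq]
    · rw [h2, heq]
    · rfl
  · rw [valueSum_image] at hsum ⊢
    rw [← Finset.add_sum_erase _ _ hj] at hsum ⊢
    have : ∑ p ∈ J.erase (z.symm j), ((Equiv.swap i j * z) p : ℕ)
        = ∑ p ∈ J.erase (z.symm j), (z p : ℕ) := by
      refine Finset.sum_congr rfl fun p hp => ?_
      rw [Finset.mem_erase] at hp
      rw [Equiv.Perm.mul_apply, Equiv.swap_apply_of_ne_of_ne]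
      · intro h; apply hi; rw [← h]; simpa using hp.2
      · intro h; apply hp.1; rw [← h]; simp
    rw [this, Equiv.Perm.mul_apply, Equiv.apply_symm_apply, Equiv.swap_apply_right]
    rw [Equiv.apply_symm_apply] at hsum
    omega

/-- For all weights `w` some permutation solves the problem of maximizing `w` under the constraint
that the sum of the values on `J` is at most the sum of `A`; the multiplier `l` certifies this. -/
theorem exists_lowered_sorted (w : Fin n → ℝ) {J A : Finset (Fin n)} (hcard : J.card = A.card) :
    ∃ (z : Equiv.Perm (Fin n)) (l : ℝ), 0 ≤ l ∧
      (Monotone fun k => loweredWeight w J l (z.symm k)) ∧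
      valueSum (J.image z) ≤ valueSum A ∧ (l = 0 ∨ valueSum (J.image z) = valueSum A) := by
  obtain ⟨z₀, hz₀⟩ := exists_sorting_perm w
  have hz₀' : Monotone fun k => loweredWeight w J 0 (z₀.symm k) := by
    simpa [loweredWeight] using hz₀
  rcases le_or_gt (valueSum (J.image z₀)) (valueSum A) with h | h
  · exact ⟨z₀, 0, le_rfl, hz₀', h, Or.inl rfl⟩
  -- The sum falls in steps of exactly one, so it reaches `valueSum A` without jumping over it.
  · have key : ∀ (d : ℕ) (z : Equiv.Perm (Fin n)) (l : ℝ), 0 ≤ l →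
        (Monotone fun k => loweredWeight w J l (z.symm k)) →
        valueSum (J.image z) = valueSum A + d →
        ∃ (z : Equiv.Perm (Fin n)) (l : ℝ), 0 ≤ l ∧
          (Monotone fun k => loweredWeight w J l (z.symm k)) ∧
          valueSum (J.image z) = valueSum A := by
      intro d
      induction d with
      | zero => exact fun z l hl hz hs => ⟨z, l, hl, hz, hs⟩
      | succ d ih =>
        intro z l hl hz hs
        obtain ⟨z', l', hll', hz', hs'⟩ := exists_lowered_sorted_step hz (m := valueSum A + d)
          (by omega) (exists_adjacent_of_valueSum_lt (A := A)
            (by rw [Finset.card_image_of_injective _ z.injective, hcard]) (by omega))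
        exact ih z' l' (hl.trans hll') hz' hs'
    obtain ⟨z, l, hl, hz, hs⟩ := key (valueSum (J.image z₀) - valueSum A) z₀ 0 le_rfl hz₀' (by omega)
    exact ⟨z, l, hl, hz, hs.le, Or.inr hs⟩

theorem exists_weights (g : (Fin n → ℝ) →L[ℝ] ℝ) :
    ∃ w : Fin n → ℝ, ∀ x, g x = ∑ i, w i * x i := by
  refine ⟨fun i => g (fun j => if i = j then 1 else 0), fun x => ?_⟩
  have := LinearMap.pi_apply_eq_sum_univ (g : (Fin n → ℝ) →ₗ[ℝ] ℝ) x
  simpa [mul_comm] using this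

/-- A point is in the convex hull of finitely many points if no linear form separates them. -/
theorem mem_convexHull_of_forall_weights {V : Set (Fin n → ℝ)} (hV : V.Finite) {x : Fin n → ℝ}
    (h : ∀ w : Fin n → ℝ, ∃ v ∈ V, ∑ i, w i * x i ≤ ∑ i, w i * v i) : x ∈ convexHull ℝ V := by
  by_contra hx
  obtain ⟨g, u, hg, hu⟩ := geometric_hahn_banach_closed_point (convex_convexHull ℝ V)
    (hV.isClosed_convexHull ℝ) hx
  obtain ⟨w, hw⟩ := exists_weights g
  obtain ⟨v, hv, hle⟩ := h w
  have := hg v (subset_convexHull ℝ V hv)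
  rw [hw] at this hu
  linarith

theorem finite_range_permPoint : (Set.range (permPoint (n := n))).Finite := Set.finite_range _

/-- The permutahedron is cut by `∑ i ∈ J, x_i = ∑ a ∈ A, (a + 1)` without new vertices. -/
theorem permutahedron_inter_halfSpace {J A : Finset (Fin n)} (hcard : J.card = A.card) :
    convexHull ℝ (permPoint '' {z | valueSum (J.image z) ≤ valueSum A}) =
      permutahedron n ∩ {x | coordSum J x ≤ (valueSum A : ℝ) + A.card} := by
  apply Set.Subset.antisymm
  · refine convexHull_min ?_ ((convex_convexHull ℝ _).inter
      (convex_halfSpace_le (coordSum J).isLinear _))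
    rintro _ ⟨z, hz, rfl⟩
    refine ⟨subset_convexHull ℝ _ ⟨z, rfl⟩, ?_⟩
    simp only [Set.mem_ofPred_eq] at hz ⊢
    rw [coordSum_permPoint, hcard]
    gcongr
  · rintro x ⟨hx, hxc⟩
    refine mem_convexHull_of_forall_weights (finite_range_permPoint.subset
      (Set.image_subset_range _ _)) fun w => ?_
    obtain ⟨z, l, hl, hz, hs, hcomp⟩ := exists_lowered_sorted w hcard
    refine ⟨permPoint z, ⟨z, hs, rfl⟩, ?_⟩
    have hsplit : ∀ y : Fin n → ℝ,
        ∑ i, loweredWeight w J l i * y i = ∑ i, w i * y i - l * coordSum J y := by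
      intro y
      rw [coordSum_apply, Finset.mul_sum]
      simp only [loweredWeight, sub_mul, Finset.sum_sub_distrib, ite_mul, zero_mul,
        Finset.sum_ite_mem, Finset.univ_inter]
    -- Weak duality: `z` is optimal on the whole permutahedron for the lowered weights. Adding back
    -- `l` times the constraint loses nothing at `z`, by complementary slackness (`h3`).
    have h1 := sum_mul_le_of_mem_permutahedron hz hx
    rw [hsplit, hsplit, coordSum_permPoint, hcard] at h1
    simp only [Set.mem_ofPred_eq] at hxc
    have h2 := mul_le_mul_of_nonneg_left hxc hl
    have h3 : l * ((valueSum A : ℝ) + A.card) = l * ((valueSum (J.image z) : ℝ) + A.card) := by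
      rcases hcomp with h | h
      · rw [h, zero_mul, zero_mul]
      · rw [h]
    linarith

/-- The form `⟨permPoint z, ·⟩` is maximal at `permPoint z`. All permutation points have the same
norm, so a second maximizer would be at distance zero. -/
theorem permPoint_mem_extremePoints (z : Equiv.Perm (Fin n)) :
    permPoint z ∈ (permutahedron n).extremePoints ℝ := by
  let q : (Fin n → ℝ) →ₗ[ℝ] ℝ := ∑ i, permPoint z i • LinearMap.proj i
  have hq : ∀ x, q x = ∑ i, permPoint z i * x i := by intro x; simp [q]
  have hmono : Monotone fun k => permPoint z (z.symm k) := by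
    intro a b hab
    simpa [permPoint] using hab
  have hface := isPolytopeFace_inter_hyperplane (convex_convexHull ℝ (Set.range (permPoint (n := n))))
    q (q (permPoint z)) (fun x hx => by
      rw [hq, hq]; exact sum_mul_le_of_mem_permutahedron hmono hx)
  have heq := hface.eq_convexHull
  have hsing : Set.range permPoint ∩ (convexHull ℝ (Set.range (permPoint (n := n))) ∩
      {x | q x = q (permPoint z)}) = {permPoint z} := by
    apply Set.Subset.antisymm
    · rintro _ ⟨⟨z', rfl⟩, -, h⟩
      simp only [Set.mem_ofPred_eq, hq] at h
      have hnorm : ∀ u : Equiv.Perm (Fin n),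
          ∑ i, permPoint u i * permPoint u i = ∑ k : Fin n, ((k : ℝ) + 1) * ((k : ℝ) + 1) :=
        fun u => Equiv.sum_comp u fun k : Fin n => ((k : ℝ) + 1) * ((k : ℝ) + 1)
      have h0 : ∑ i, (permPoint z i - permPoint z' i) ^ 2 = 0 := by
        have : ∀ i, (permPoint z i - permPoint z' i) ^ 2 = permPoint z i * permPoint z i -
            2 * (permPoint z i * permPoint z' i) + permPoint z' i * permPoint z' i :=
          fun i => by ring
        simp only [this, Finset.sum_add_distrib, Finset.sum_sub_distrib, ← Finset.mul_sum, h,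
          hnorm]
        ring
      rw [Finset.sum_eq_zero_iff_of_nonneg fun i _ => sq_nonneg _] at h0
      rw [Set.mem_singleton_iff]
      ext i
      have := h0 i (Finset.mem_univ i)
      rw [sq_eq_zero_iff] at this
      linarith
    · rintro _ rfl
      exact ⟨⟨z, rfl⟩, subset_convexHull ℝ _ ⟨z, rfl⟩, rfl⟩
  rw [hsing, convexHull_singleton] at heq
  rw [heq] at hface
  exact isExtreme_singleton.1 hface.2

end SortedWeights

/-! ### Matroids with a bound on one subset, and their quotients. -/

section BoundedMatroid

variable {α : Type*} [Finite α]

/-- The matroid whose independent sets have at most `k` elements, at most `a` of them in `J`. -/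
def boundedMatroid (J : Set α) (k a : ℕ) : Matroid α :=
  (IndepMatroid.ofFinite (E := Set.univ) Set.finite_univ
    (fun I => I.ncard ≤ k ∧ (I ∩ J).ncard ≤ a) (by simp)
    (fun I I' h hI => ⟨(Set.ncard_le_ncard hI (Set.toFinite _)).trans h.1,
      (Set.ncard_le_ncard (Set.inter_subset_inter_left _ hI) (Set.toFinite _)).trans h.2⟩)
    (by
      intro I I' hI hI' hlt
      -- With room in `J`, any new element of `I'` can be added. Otherwise `I` has at least as many
      -- elements in `J` as `I'`, so `I'` has more outside `J`, where the bound is irrelevant.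
      by_cases h : (I ∩ J).ncard < a
      · obtain ⟨e, he, heI⟩ := Set.exists_mem_notMem_of_ncard_lt_ncard hlt (Set.toFinite _)
        refine ⟨e, he, heI, ?_, ?_⟩
        · exact (Set.ncard_insert_le e I).trans (by omega)
        · refine (Set.ncard_le_ncard (t := insert e (I ∩ J)) ?_ (Set.toFinite _)).trans
            ((Set.ncard_insert_le _ _).trans h)
          rintro x ⟨rfl | hx, hxJ⟩
          · exact Or.inl rfl
          · exact Or.inr ⟨hx, hxJ⟩
      · have e1 := Set.ncard_inter_add_ncard_sdiff_eq_ncard I J (Set.toFinite _)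
        have e2 := Set.ncard_inter_add_ncard_sdiff_eq_ncard I' J (Set.toFinite _)
        obtain ⟨e, he, heI⟩ := Set.exists_mem_notMem_of_ncard_lt_ncard (s := I \ J) (t := I' \ J)
          (by omega) (Set.toFinite _)
        refine ⟨e, he.1, fun h' => heI ⟨h', he.2⟩, (Set.ncard_insert_le e I).trans (by omega), ?_⟩
        rw [Set.insert_inter_of_notMem he.2]
        exact hI.2)
    (fun I _ => Set.subset_univ I)).matroid

theorem boundedMatroid_indep {J : Set α} {k a : ℕ} {I : Set α} :
    (boundedMatroid J k a).Indep I ↔ I.ncard ≤ k ∧ (I ∩ J).ncard ≤ a := Iff.rfl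

theorem boundedMatroid_isBase {J : Set α} {k a : ℕ}
    (hex : ∃ B : Set α, B.ncard = k ∧ (B ∩ J).ncard ≤ a) {B : Set α} :
    (boundedMatroid J k a).IsBase B ↔ B.ncard = k ∧ (B ∩ J).ncard ≤ a := by
  have hback : ∀ B : Set α, B.ncard = k → (B ∩ J).ncard ≤ a → (boundedMatroid J k a).IsBase B := by
    intro B hB hBJ
    rw [Matroid.isBase_iff_maximal_indep]
    refine ⟨⟨hB.le, hBJ⟩, fun I hI hBI => ?_⟩
    exact (Set.eq_of_subset_of_ncard_le hBI (hI.1.trans hB.ge) (Set.toFinite _)).symm.subset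
  refine ⟨fun h => ?_, fun h => hback B h.1 h.2⟩
  obtain ⟨B₀, h1, h2⟩ := hex
  have := h.ncard_eq_ncard_of_isBase (hback B₀ h1 h2)
  exact ⟨this.trans h1, h.indep.2⟩

/-- If the bound on `J` grows at most as fast as the rank, flats remain flats. -/
theorem boundedMatroid_isFlat_succ {J : Set α} {k a b : ℕ} (hab : a ≤ b) (hba : b ≤ a + 1)
    {F : Set α} (hF : (boundedMatroid J k a).IsFlat F) : (boundedMatroid J (k + 1) b).IsFlat F := by
  refine ⟨?_, Set.subset_univ F⟩
  intro I' X hI'F hI'X x hxX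
  by_contra hxF
  obtain ⟨I, hI⟩ := (boundedMatroid J k a).exists_isBasis F (Set.subset_univ F)
  have hxI : x ∉ I := fun h => hxF (hI.subset h)
  have hxI' : x ∉ I' := fun h => hxF (hI'F.subset h)
  -- Since `F` is closed in the smaller matroid, `x` can be added to its basis `I`, whereas `x`
  -- cannot be added to `I'` in the larger one. The aim is an element of `F` that enlarges `I`.
  have hins : (boundedMatroid J k a).Indep (insert x I) := by
    rw [← hI.indep.notMem_closure_iff_of_notMem hxI (Set.mem_univ x), hI.closure_eq_closure,
      hF.closure]
    exact hxF
  have hmax : ∀ e ∈ F, (boundedMatroid J k a).Indep (insert e I) → e ∈ I :=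
    fun e he h => hI.mem_of_insert_indep he h
  have hnot : ¬ (boundedMatroid J (k + 1) b).Indep (insert x I') :=
    fun h => hxI' (hI'X.mem_of_insert_indep hxX h)
  have hI'i := hI'F.indep
  rw [boundedMatroid_indep] at hins hnot hI'i
  rw [Set.ncard_insert_of_notMem hxI (Set.toFinite _)] at hins
  rw [Set.ncard_insert_of_notMem hxI' (Set.toFinite _)] at hnot
  by_cases hcard : I'.ncard = k + 1
  · obtain ⟨y, hy, hyJ⟩ : ∃ y ∈ I', a < (I' ∩ J).ncard → y ∈ J := by
      by_cases h : a < (I' ∩ J).ncard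
      · obtain ⟨y, hy⟩ : (I' ∩ J).Nonempty := by
          rw [← Set.ncard_pos (Set.toFinite _)]; omega
        exact ⟨y, hy.1, fun _ => hy.2⟩
      · obtain ⟨y, hy⟩ : I'.Nonempty := by
          rw [← Set.ncard_pos (Set.toFinite _)]; omega
        exact ⟨y, hy, fun h' => absurd h' h⟩
    have hdel : (boundedMatroid J k a).Indep (I' \ {y}) := by
      have hc := Set.ncard_sdiff_singleton_add_one hy (Set.toFinite _)
      refine ⟨by omega, ?_⟩
      by_cases h : a < (I' ∩ J).ncard
      · have hyJ' : y ∈ I' ∩ J := ⟨hy, hyJ h⟩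
        have : (I' \ {y}) ∩ J = (I' ∩ J) \ {y} := by ext; simp; tauto
        rw [this]
        have := Set.ncard_sdiff_singleton_add_one hyJ' (Set.toFinite _)
        omega
      · exact (Set.ncard_le_ncard (Set.inter_subset_inter_left _ Set.sdiff_subset)
          (Set.toFinite _)).trans (not_lt.1 h)
    have hc := Set.ncard_sdiff_singleton_add_one hy (Set.toFinite _)
    obtain ⟨e, he, hei⟩ := hI.indep.augment hdel (by
      rw [← (Set.toFinite _).cast_ncard_eq, ← (Set.toFinite _).cast_ncard_eq]
      exact_mod_cast (by omega))
    exact he.2 (hmax e (hI'F.subset he.1.1) hei)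
  -- Here the bound on `J` blocks `x`, so `I'` has at least `b` elements in `J`, whereas `I` has
  -- fewer than `a`.
  · have hxJ : x ∈ J := by
      by_contra h
      rw [Set.insert_inter_of_notMem h] at hnot
      omega
    rw [Set.insert_inter_of_mem hxJ, Set.ncard_insert_of_notMem (fun h => hxI' h.1)
      (Set.toFinite _)] at hnot
    rw [Set.insert_inter_of_mem hxJ, Set.ncard_insert_of_notMem (fun h => hxI h.1)
      (Set.toFinite _)] at hins
    obtain ⟨e, he, heI⟩ := Set.exists_mem_notMem_of_ncard_lt_ncard (s := I ∩ J) (t := I' ∩ J)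
      (by omega) (Set.toFinite _)
    have heI' : e ∉ I := fun h => heI ⟨h, he.2⟩
    refine heI' (hmax e (hI'F.subset he.1) ⟨?_, ?_⟩)
    · rw [Set.ncard_insert_of_notMem heI' (Set.toFinite _)]
      exact hins.1
    · rw [Set.insert_inter_of_mem he.2, Set.ncard_insert_of_notMem heI (Set.toFinite _)]
      exact hins.2

end BoundedMatroid

/-! ### The Gale order by thresholds, and lattice path matroids. -/

section Gale

variable {n : ℕ}

theorem countGE_eq_card_orderEmb {S : Finset (Fin n)} {k : ℕ} (h : S.card = k) (t : ℕ) :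
    countGE S t = (Finset.univ.filter fun i : Fin k => t ≤ (S.orderEmbOfFin h i : ℕ)).card := by
  unfold countGE
  symm
  refine Finset.card_bij (fun i _ => S.orderEmbOfFin h i) ?_ ?_ ?_
  · intro i hi
    rw [Finset.mem_filter] at hi ⊢
    exact ⟨S.orderEmbOfFin_mem h i, hi.2⟩
  · intro i _ j _ hij
    exact (S.orderEmbOfFin h).injective hij
  · intro b hb
    rw [Finset.mem_filter] at hb
    have : b ∈ Set.range (S.orderEmbOfFin h) := by
      rw [Finset.range_orderEmbOfFin]; exact hb.1
    obtain ⟨i, rfl⟩ := this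
    exact ⟨i, by simpa using hb.2, rfl⟩

theorem galeLE_iff {A B : Finset (Fin n)} :
    GaleLE A B ↔ A.card = B.card ∧ ∀ t, countGE A t ≤ countGE B t := by
  constructor
  · rintro ⟨k, hA, hB, h⟩
    refine ⟨hA.trans hB.symm, fun t => ?_⟩
    rw [countGE_eq_card_orderEmb hA, countGE_eq_card_orderEmb hB]
    exact Finset.card_le_card (Finset.monotone_filter_right _ fun i _ hi => le_trans hi (h i))
  · rintro ⟨hcard, h⟩
    refine ⟨B.card, hcard, rfl, fun i => ?_⟩
    by_contra hlt
    rw [not_le] at hlt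
    -- If `a_i > b_i`, take the threshold `a_i`: the indices counted for `B` all exceed `i`, so they
    -- are counted for `A`, which also counts `i` itself.
    have h1 := h (A.orderEmbOfFin hcard i)
    rw [countGE_eq_card_orderEmb hcard, countGE_eq_card_orderEmb (rfl : B.card = B.card)] at h1
    have h2 : (Finset.univ.filter fun i' : Fin B.card =>
        ((A.orderEmbOfFin hcard i : Fin n) : ℕ) ≤ (B.orderEmbOfFin rfl i' : ℕ)).card
        < (Finset.univ.filter fun i' : Fin B.card =>
        ((A.orderEmbOfFin hcard i : Fin n) : ℕ) ≤ (A.orderEmbOfFin hcard i' : ℕ)).card := by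
      apply Finset.card_lt_card
      rw [Finset.ssubset_iff_of_subset]
      · refine ⟨i, by simp, ?_⟩
        simp only [Finset.mem_filter, Finset.mem_univ, true_and, not_le]
        exact hlt
      · intro i' hi'
        simp only [Finset.mem_filter, Finset.mem_univ, true_and, Fin.val_fin_le] at hi' ⊢
        have h3 := hlt.trans_le hi'
        rw [OrderEmbedding.lt_iff_lt] at h3
        exact (A.orderEmbOfFin hcard).monotone h3.le
    omega

theorem countGE_le_add (S : Finset (Fin n)) (s d : ℕ) : countGE S s ≤ countGE S (s + d) + d := by
  induction d with
  | zero => simp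
  | succ d ih =>
    refine ih.trans ?_
    by_cases h : s + d < n
    · have := countGE_eq_succ S ⟨s + d, h⟩
      simp only at this
      rw [← add_assoc s d 1]
      split_ifs at this <;> omega
    · rw [countGE_of_le S (by omega)]; omega

theorem countGE_le_sub (S : Finset (Fin n)) (t : ℕ) : countGE S t ≤ n - t := by
  rcases le_or_gt n t with h | h
  · rw [countGE_of_le S h]; exact Nat.zero_le _
  · have := countGE_le_add S t (n - t)
    rwa [countGE_of_le S (t := t + (n - t)) (by omega), zero_add] at this

theorem countGE_le_card (S : Finset (Fin n)) (t : ℕ) : countGE S t ≤ S.card :=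
  Finset.card_filter_le _ _

/-- The interval `{l, …, r - 1}` of `Fin n`. -/
def finInterval (n l r : ℕ) : Finset (Fin n) :=
  Finset.univ.filter fun p => l ≤ (p : ℕ) ∧ (p : ℕ) < r

theorem countGE_finInterval {l r : ℕ} (hr : r ≤ n) (t : ℕ) :
    countGE (finInterval n l r) t = r - max l t := by
  rw [countGE, finInterval, Finset.filter_filter, ← Nat.card_Ico,
    ← Finset.card_image_of_injective _ Fin.val_injective]
  congr 1
  ext a
  simp only [Finset.mem_image, Finset.mem_filter, Finset.mem_univ, true_and, Finset.mem_Ico,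
    sup_le_iff]
  constructor
  · rintro ⟨p, h, rfl⟩; omega
  · intro h; exact ⟨⟨a, by omega⟩, by simp only; omega, rfl⟩

theorem countGE_union {S T : Finset (Fin n)} (h : Disjoint S T) (t : ℕ) :
    countGE (S ∪ T) t = countGE S t + countGE T t := by
  rw [countGE, Finset.filter_union, Finset.card_union_of_disjoint]
  · rfl
  · exact Finset.disjoint_filter_filter h

theorem disjoint_finInterval {l r l' r' : ℕ} (h : r ≤ l') :
    Disjoint (finInterval n l r) (finInterval n l' r') := by
  rw [Finset.disjoint_left]
  intro p hp hp'
  simp only [finInterval, Finset.mem_filter] at hp hp'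
  omega

theorem countGE_univ (t : ℕ) : countGE (Finset.univ : Finset (Fin n)) t = n - t := by
  have : (Finset.univ : Finset (Fin n)) = finInterval n 0 n := by
    ext p; simp [finInterval]
  rw [this, countGE_finInterval le_rfl]
  simp

theorem card_inter_initialPositions (B : Finset (Fin n)) (j : ℕ) :
    (B ∩ initialPositions n j).card + countGE B j = B.card := by
  rw [← Finset.card_filter_add_card_filter_not (s := B) (fun p : Fin n => (p : ℕ) < j)]
  congr 1
  · congr 1
    ext p; simp [mem_initialPositions]
  · rw [countGE]
    congr 1
    ext p; simp

theorem card_inter_compl_initialPositions (B : Finset (Fin n)) (j : ℕ) :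
    (B ∩ (initialPositions n j)ᶜ).card = countGE B j := by
  rw [countGE]
  congr 1
  ext p; simp [mem_initialPositions]

theorem ncard_coe_inter (B J : Finset (Fin n)) :
    ((B : Set (Fin n)) ∩ J).ncard = (B ∩ J).card := by
  rw [← Finset.coe_inter, Set.ncard_coe_finset]

/-- The least basis `U` takes the first `a` elements of `J` and the first `k - a` after `J`; `L` is
the greatest `k`-set. The Gale inequality with `U` at the threshold `j` is the bound on `J`, and it
implies the others because counts drop by at most one per threshold. -/
theorem isLatticePathMatroid_initial {j k a : ℕ} (hj : j ≤ n) (hk : k ≤ n) (haj : a ≤ j)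
    (hak : a ≤ k) (hkj : k - a ≤ n - j)
    (hex : ∃ B : Set (Fin n), B.ncard = k ∧ (B ∩ (initialPositions n j : Finset (Fin n))).ncard ≤ a) :
    ∃ U L : Finset (Fin n), U.card = k ∧ L.card = k ∧
      IsLatticePathMatroid (boundedMatroid (initialPositions n j : Set (Fin n)) k a) U L := by
  have hU : ∀ t, countGE (finInterval n 0 a ∪ finInterval n j (j + (k - a))) t
      = (a - max 0 t) + (j + (k - a) - max j t) := by
    intro t
    rw [countGE_union (disjoint_finInterval haj), countGE_finInterval (by omega),
      countGE_finInterval (by omega)]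
  have hL : ∀ t, countGE (finInterval n (n - k) n) t = n - max (n - k) t :=
    countGE_finInterval le_rfl
  set U := finInterval n 0 a ∪ finInterval n j (j + (k - a))
  set L := finInterval n (n - k) n
  have hUc : U.card = k := by rw [← countGE_zero, hU]; omega
  have hLc : L.card = k := by rw [← countGE_zero, hL]; omega
  have hBL : ∀ B : Finset (Fin n), B.card = k → GaleLE B L := by
    intro B hB
    refine galeLE_iff.2 ⟨hB.trans hLc.symm, fun t => ?_⟩
    rw [hL]
    have h1 := countGE_le_sub B t
    have h2 := countGE_le_card B t
    omega
  refine ⟨U, L, hUc, hLc, hBL U hUc, rfl, fun B => ?_⟩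
  rw [boundedMatroid_isBase hex, Set.ncard_coe_finset, ncard_coe_inter]
  have hc := card_inter_initialPositions B j
  constructor
  · rintro ⟨hB, hBJ⟩
    refine ⟨galeLE_iff.2 ⟨hUc.trans hB.symm, fun t => ?_⟩, hBL B hB⟩
    rw [hU]
    rcases le_total t j with h | h
    · have h1 := countGE_anti B h
      have h2 := countGE_le_add B 0 t
      rw [countGE_zero, zero_add] at h2
      omega
    · have h2 := countGE_le_add B j (t - j)
      rw [Nat.add_sub_cancel' h] at h2
      omega
  · rintro ⟨h1, h2⟩
    rw [galeLE_iff] at h1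
    have h3 := h1.2 j
    rw [hU] at h3
    omega

/-- Mirror image of the initial case: now `U` imposes nothing, and the threshold `j` for `L` carries
the bound. -/
theorem isLatticePathMatroid_final {j k a : ℕ} (hj : j ≤ n) (hk : k ≤ n) (haj : a ≤ n - j)
    (hak : a ≤ k) (hkj : k - a ≤ j)
    (hex : ∃ B : Set (Fin n), B.ncard = k ∧
      (B ∩ ((initialPositions n j)ᶜ : Finset (Fin n))).ncard ≤ a) :
    ∃ U L : Finset (Fin n), U.card = k ∧ L.card = k ∧
      IsLatticePathMatroid
        (boundedMatroid (((initialPositions n j)ᶜ : Finset (Fin n)) : Set (Fin n)) k a) U L := by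
  have hL : ∀ t, countGE (finInterval n (j - (k - a)) j ∪ finInterval n (n - a) n) t
      = (j - max (j - (k - a)) t) + (n - max (n - a) t) := by
    intro t
    rw [countGE_union (disjoint_finInterval (by omega)), countGE_finInterval (by omega),
      countGE_finInterval (by omega)]
  have hU : ∀ t, countGE (finInterval n 0 k) t = k - max 0 t := countGE_finInterval hk
  set L := finInterval n (j - (k - a)) j ∪ finInterval n (n - a) n
  set U := finInterval n 0 k
  have hUc : U.card = k := by rw [← countGE_zero, hU]; omega
  have hLc : L.card = k := by rw [← countGE_zero, hL]; omega
  have hUB : ∀ B : Finset (Fin n), B.card = k → GaleLE U B := by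
    intro B hB
    refine galeLE_iff.2 ⟨hUc.trans hB.symm, fun t => ?_⟩
    rw [hU]
    have h2 := countGE_le_add B 0 t
    rw [countGE_zero, zero_add] at h2
    omega
  refine ⟨U, L, hUc, hLc, hUB L hLc, rfl, fun B => ?_⟩
  rw [boundedMatroid_isBase hex, Set.ncard_coe_finset, ncard_coe_inter,
    card_inter_compl_initialPositions]
  constructor
  · rintro ⟨hB, hBJ⟩
    refine ⟨hUB B hB, galeLE_iff.2 ⟨hB.trans hLc.symm, fun t => ?_⟩⟩
    rw [hL]
    have h0 := countGE_le_card B t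
    rcases le_total t j with h | h
    · have h2 := countGE_le_add B t (j - t)
      rw [Nat.add_sub_cancel' h] at h2
      omega
    · have h1 := countGE_anti B h
      have h2 := countGE_le_sub B t
      omega
  · rintro ⟨h1, h2⟩
    rw [galeLE_iff] at h1 h2
    have h3 := h2.2 j
    rw [hL] at h3
    omega

end Gale

/-! ### Cells as flag matroid polytopes. -/

section FlagPolytope

variable {n : ℕ}

/-- The positions where a permutation takes one of its `i + 1` largest values. -/
def topPositions (z : Equiv.Perm (Fin n)) (i : Fin n) : Finset (Fin n) :=
  Finset.univ.filter fun p => (i.rev : ℕ) ≤ z p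

theorem card_topPositions (z : Equiv.Perm (Fin n)) (i : Fin n) :
    (topPositions z i).card = i + 1 := by
  have := countGE_image z Finset.univ i.rev
  rw [Finset.image_univ_of_surjective z.surjective, countGE_univ] at this
  rw [topPositions, ← this, Fin.val_rev]
  omega

theorem card_topPositions_inter (z : Equiv.Perm (Fin n)) (i : Fin n) (J : Finset (Fin n)) :
    (topPositions z i ∩ J).card = countGE (J.image z) i.rev := by
  rw [countGE_image]
  congr 1
  ext p; simp [topPositions, and_comm]

theorem card_filter_rev_le (a : Fin n) :
    (Finset.univ.filter fun i : Fin n => (i.rev : ℕ) ≤ a).card = a + 1 := by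
  rw [← card_topPositions (1 : Equiv.Perm (Fin n)) a, topPositions]
  congr 1
  ext i
  rw [Finset.mem_filter, Finset.mem_filter, Equiv.Perm.one_apply, Fin.val_rev, Fin.val_rev]
  have h1 := i.isLt
  have h2 := a.isLt
  simp only [Finset.mem_univ, true_and]
  omega

/-- Position `p` belongs to exactly `z p + 1` of the sets. -/
theorem sum_indicator_topPositions (z : Equiv.Perm (Fin n)) :
    ∑ i, (topPositions z i : Set (Fin n)).indicator (fun _ => (1 : ℝ)) = permPoint z := by
  ext p
  rw [Finset.sum_apply]
  have : ∀ i, (topPositions z i : Set (Fin n)).indicator (fun _ => (1 : ℝ)) p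
      = if (i.rev : ℕ) ≤ z p then 1 else 0 := by
    intro i
    simp [Set.indicator_apply, topPositions]
  simp only [this, Finset.sum_boole, card_filter_rev_le, permPoint]
  push_cast
  rfl

/-- Double counting: `a` passes `a + 1` thresholds. This links the Gale order to value sums. -/
theorem sum_countGE (A : Finset (Fin n)) :
    ∑ i : Fin n, countGE A i.rev = valueSum A + A.card := by
  unfold countGE valueSum
  simp only [Finset.card_filter]
  rw [Finset.sum_comm]
  simp only [← Finset.card_filter, card_filter_rev_le, Finset.sum_add_distrib, Finset.sum_const,
    smul_eq_mul, mul_one]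

/-- Greedy exchange: `θ`, the weight at the least of the top values, separates the weights in
`topPositions z i` from those outside. -/
theorem sum_le_sum_topPositions {w : Fin n → ℝ} {z : Equiv.Perm (Fin n)}
    (hz : Monotone fun k => w (z.symm k)) {i : Fin n} {B : Finset (Fin n)}
    (hB : B.card = i + 1) : ∑ p ∈ B, w p ≤ ∑ p ∈ topPositions z i, w p := by
  set T := topPositions z i with hT
  set θ := w (z.symm i.rev) with hθ
  have hTc : T.card = i + 1 := card_topPositions z i
  have hin : ∀ p ∈ T, θ ≤ w p := by
    intro p hp
    simp only [hT, topPositions, Finset.mem_filter, Finset.mem_univ, true_and,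
      Fin.val_fin_le] at hp
    simpa using hz hp
  have hout : ∀ p ∉ T, w p ≤ θ := by
    intro p hp
    simp only [hT, topPositions, Finset.mem_filter, Finset.mem_univ, true_and, Fin.val_fin_le,
      not_le] at hp
    simpa using hz hp.le
  have h1 : ∑ p ∈ B \ T, w p ≤ (B \ T).card • θ :=
    Finset.sum_le_card_nsmul _ _ _ fun p hp => hout p (Finset.mem_sdiff.1 hp).2
  have h2 : (T \ B).card • θ ≤ ∑ p ∈ T \ B, w p :=
    Finset.card_nsmul_le_sum _ _ _ fun p hp => hin p (Finset.mem_sdiff.1 hp).1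
  rw [← Finset.card_sdiff_comm (hB.trans hTc.symm)] at h2
  have h3 := Finset.sum_inter_add_sum_sdiff B T w
  have h4 := Finset.sum_inter_add_sum_sdiff T B w
  rw [Finset.inter_comm] at h4
  linarith

/-- The sets need not be nested. For any weights, one sorting permutation maximizes every summand at
once. -/
theorem sum_indicator_mem_permutahedron {B : Fin n → Set (Fin n)}
    (hB : ∀ i, (B i).ncard = i + 1) :
    ∑ i, (B i).indicator (fun _ => (1 : ℝ)) ∈ permutahedron n := by
  classical
  refine mem_convexHull_of_forall_weights finite_range_permPoint fun w => ?_
  obtain ⟨z, hz⟩ := exists_sorting_perm w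
  refine ⟨_, ⟨z, rfl⟩, ?_⟩
  have hsum : ∀ C : Fin n → Set (Fin n), ∑ p, w p * (∑ i, (C i).indicator (fun _ => (1 : ℝ))) p
      = ∑ i, ∑ p ∈ (C i).toFinset, w p := by
    intro C
    simp only [Finset.sum_apply, Finset.mul_sum]
    rw [Finset.sum_comm]
    refine Finset.sum_congr rfl fun i _ => ?_
    simp only [Set.indicator_apply, mul_ite, mul_one, mul_zero]
    rw [← Finset.sum_filter]
    refine Finset.sum_congr ?_ fun _ _ => rfl
    ext p; simp
  rw [← sum_indicator_topPositions z, hsum, hsum]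
  refine Finset.sum_le_sum fun i _ => ?_
  rw [Finset.toFinset_coe]
  refine sum_le_sum_topPositions hz ?_
  rw [← Set.ncard_eq_toFinset_card', hB]

theorem exists_perm_image_eq {J A : Finset (Fin n)} (hcard : J.card = A.card) :
    ∃ z : Equiv.Perm (Fin n), J.image z = A := by
  let e : {x // x ∈ J} ≃ {x // x ∈ A} := Finset.equivOfCardEq hcard
  refine ⟨e.extendSubtype, ?_⟩
  apply Finset.eq_of_subset_of_card_le
  · intro a ha
    obtain ⟨p, hp, rfl⟩ := Finset.mem_image.1 ha
    exact e.extendSubtype_mem p hp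
  · rw [Finset.card_image_of_injective _ (Equiv.injective _), hcard]

/-- The constituents of the flag of the permutations which map `J` to a set below `A`. -/
def flagConstituent (J A : Finset (Fin n)) (i : Fin n) : Matroid (Fin n) :=
  boundedMatroid (J : Set (Fin n)) (i + 1) (countGE A i.rev)

theorem topPositions_bounded {J A : Finset (Fin n)} {z : Equiv.Perm (Fin n)}
    (hz : z ∈ dominated J A) (i : Fin n) :
    (topPositions z i : Set (Fin n)).ncard = i + 1 ∧
      ((topPositions z i : Set (Fin n)) ∩ J).ncard ≤ countGE A i.rev := by
  rw [Set.ncard_coe_finset, ncard_coe_inter, card_topPositions, card_topPositions_inter]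
  exact ⟨rfl, hz _⟩

theorem exists_bounded {J A : Finset (Fin n)} (hcard : J.card = A.card) (i : Fin n) :
    ∃ B : Set (Fin n), B.ncard = i + 1 ∧ (B ∩ J).ncard ≤ countGE A i.rev := by
  obtain ⟨z, hz⟩ := exists_perm_image_eq hcard
  exact ⟨_, topPositions_bounded (z := z) (fun t => by rw [hz]) i⟩

/-- Top positions of a dominated permutation are bases. Conversely a sum of bases lies in the
permutahedron, and its sum over `J` is `∑ i, |B i ∩ J|`, at most `valueSum A + A.card` by
`sum_countGE`; by `hcut` nothing more is needed. -/
theorem flagMatroidPolytope_flagConstituent {J A : Finset (Fin n)} (hcard : J.card = A.card)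
    (hcut : convexHull ℝ (permPoint '' dominated J A) =
      permutahedron n ∩ {x | coordSum J x ≤ (valueSum A : ℝ) + A.card}) :
    convexHull ℝ (permPoint '' dominated J A) = flagMatroidPolytope (flagConstituent J A) := by
  have hbase : ∀ i B, (flagConstituent J A i).IsBase B ↔
      B.ncard = i + 1 ∧ (B ∩ J).ncard ≤ countGE A i.rev :=
    fun i B => boundedMatroid_isBase (exists_bounded hcard i)
  unfold flagMatroidPolytope matroidPolytope
  rw [← convexHull_sum]
  apply Set.Subset.antisymm
  · apply convexHull_mono
    rintro _ ⟨z, hz, rfl⟩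
    rw [← sum_indicator_topPositions]
    refine Set.finsetSum_mem_finsetSum _ _ _ fun i _ => ?_
    exact ⟨_, (hbase i _).2 (topPositions_bounded hz i), rfl⟩
  · rw [hcut]
    refine convexHull_min ?_ ((convex_convexHull ℝ _).inter
      (convex_halfSpace_le (coordSum J).isLinear _))
    intro x hx
    rw [Set.mem_finsetSum] at hx
    obtain ⟨g, hg, rfl⟩ := hx
    choose B hB hBg using fun i => hg (Finset.mem_univ i)
    simp only [Set.mem_ofPred_eq, hbase] at hB
    simp only at hBg
    rw [← Finset.sum_congr rfl fun i _ => hBg i]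
    refine ⟨sum_indicator_mem_permutahedron fun i => (hB i).1, ?_⟩
    rw [Set.mem_ofPred_eq, map_sum]
    simp only [coordSum_apply]
    have : ∀ i, ∑ p ∈ J, (B i).indicator (fun _ => (1 : ℝ)) p = ((B i ∩ J).ncard : ℝ) := by
      classical
      intro i
      simp only [Set.indicator_apply, Finset.sum_boole]
      rw [← Set.ncard_coe_finset]
      congr 2
      ext p; simp [and_comm]
    simp only [this]
    rw [← Nat.cast_add, ← sum_countGE]
    push_cast
    exact Finset.sum_le_sum fun i _ => by exact_mod_cast (hB i).2

theorem isLPFMPolytope_of_latticePath {J A : Finset (Fin n)} (hcard : J.card = A.card)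
    (hcut : convexHull ℝ (permPoint '' dominated J A) =
      permutahedron n ∩ {x | coordSum J x ≤ (valueSum A : ℝ) + A.card})
    (hlp : ∀ i : Fin n, ∃ U L : Finset (Fin n), U.card = (i : ℕ) + 1 ∧ L.card = (i : ℕ) + 1 ∧
      IsLatticePathMatroid (flagConstituent J A i) U L) :
    IsLPFMPolytope (convexHull ℝ (permPoint '' dominated J A)) := by
  refine ⟨flagConstituent J A, ⟨hlp, ?_⟩, flagMatroidPolytope_flagConstituent hcard hcut⟩
  intro i j hij
  refine ⟨rfl, fun F hF => ?_⟩
  -- Consecutive constituents have bounds that differ by 0 or 1, as the quotient lemma requires.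
  have hstep := countGE_eq_succ A j.rev
  have hrev : (j.rev : ℕ) + 1 = i.rev := by
    have := j.isLt
    rw [Fin.val_rev, Fin.val_rev]; omega
  rw [hrev] at hstep
  unfold flagConstituent at hF ⊢
  rw [← hij]
  apply boundedMatroid_isFlat_succ _ _ hF <;> split_ifs at hstep <;> omega

theorem sub_countGE_le {A : Finset (Fin n)} (i : Fin n) :
    (i : ℕ) + 1 - countGE A i.rev ≤ n - A.card := by
  have h1 := countGE_compl_add A i.rev
  have h2 := countGE_le_card Aᶜ i.rev
  rw [countGE_univ, Fin.val_rev] at h1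
  rw [Finset.card_compl, Fintype.card_fin] at h2
  rw [Fin.val_rev] at *
  omega

theorem countGE_rev_le_succ (A : Finset (Fin n)) (i : Fin n) : countGE A i.rev ≤ i + 1 := by
  have := countGE_le_sub A i.rev
  rw [Fin.val_rev] at *
  omega

theorem isLPFMPolytope_initial {A : Finset (Fin n)} {j : ℕ} (hA : A.card = j)
    (hcut : convexHull ℝ (permPoint '' dominated (initialPositions n j) A) =
      permutahedron n ∩
        {x | coordSum (initialPositions n j) x ≤ (valueSum A : ℝ) + A.card}) :
    IsLPFMPolytope (convexHull ℝ (permPoint '' dominated (initialPositions n j) A)) := by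
  have hj : j ≤ n := by simpa [hA] using A.card_le_univ
  have hcard : (initialPositions n j).card = A.card := by rw [card_initialPositions hj, hA]
  refine isLPFMPolytope_of_latticePath hcard hcut fun i => ?_
  have h1 := sub_countGE_le (A := A) i
  rw [hA] at h1
  exact isLatticePathMatroid_initial hj i.isLt (hA ▸ countGE_le_card A _)
    (countGE_rev_le_succ A i) h1 (exists_bounded hcard i)

theorem isLPFMPolytope_final {A : Finset (Fin n)} {j : ℕ} (hj : j ≤ n) (hA : A.card = n - j)
    (hcut : convexHull ℝ (permPoint '' dominated (initialPositions n j)ᶜ A) =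
      permutahedron n ∩
        {x | coordSum (initialPositions n j)ᶜ x ≤ (valueSum A : ℝ) + A.card}) :
    IsLPFMPolytope (convexHull ℝ (permPoint '' dominated (initialPositions n j)ᶜ A)) := by
  have hcard : (initialPositions n j)ᶜ.card = A.card := by
    rw [Finset.card_compl, card_initialPositions hj, hA, Fintype.card_fin]
  refine isLPFMPolytope_of_latticePath hcard hcut fun i => ?_
  have h1 := sub_countGE_le (A := A) i
  rw [hA] at h1
  exact isLatticePathMatroid_final hj i.isLt (hA ▸ countGE_le_card A _)
    (countGE_rev_le_succ A i) (by omega) (exists_bounded hcard i)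

end FlagPolytope

/-! ### Gale-comparable sets and their splits. -/

section GaleComparable

variable {n : ℕ}

theorem valueSum_le_of_countGE_le {S A : Finset (Fin n)} (hcard : S.card = A.card)
    (h : ∀ t, countGE S t ≤ countGE A t) : valueSum S ≤ valueSum A := by
  have h1 := sum_countGE S
  have h2 := sum_countGE A
  have h3 : ∑ i : Fin n, countGE S i.rev ≤ ∑ i : Fin n, countGE A i.rev :=
    Finset.sum_le_sum fun i _ => h _
  omega

theorem valueSum_lt_of_countGE_lt {S A : Finset (Fin n)} (hcard : S.card = A.card)
    (h : ∀ t, countGE S t ≤ countGE A t) {t : ℕ} (ht : countGE S t < countGE A t) :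
    valueSum S < valueSum A := by
  have htn : t < n := by
    by_contra hge
    rw [countGE_of_le A (not_lt.1 hge)] at ht
    omega
  have h1 := sum_countGE S
  have h2 := sum_countGE A
  have h3 : ∑ i : Fin n, countGE S i.rev < ∑ i : Fin n, countGE A i.rev :=
    Finset.sum_lt_sum (fun i _ => h _) ⟨(⟨t, htn⟩ : Fin n).rev, Finset.mem_univ _, by
      rw [Fin.rev_rev]; exact ht⟩
  omega

/-- `A` is comparable in the Gale order with all sets of its size. -/
def GaleComparable (A : Finset (Fin n)) : Prop :=
  ∀ S : Finset (Fin n), S.card = A.card →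
    (∀ t, countGE S t ≤ countGE A t) ∨ (∀ t, countGE A t ≤ countGE S t)

/-- The value sum is strictly monotone in the Gale order, so for comparable sets it decides the
direction. -/
theorem GaleComparable.countGE_le {A S : Finset (Fin n)} (hA : GaleComparable A)
    (hcard : S.card = A.card) (h : valueSum S ≤ valueSum A) (t : ℕ) :
    countGE S t ≤ countGE A t := by
  rcases hA S hcard with h' | h'
  · exact h' t
  · by_contra hlt
    have := valueSum_lt_of_countGE_lt hcard.symm h' (not_le.1 hlt)
    omega

theorem countGE_compl_le_iff {S A : Finset (Fin n)} (t : ℕ) :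
    countGE Sᶜ t ≤ countGE Aᶜ t ↔ countGE A t ≤ countGE S t := by
  have h1 := countGE_compl_add S t
  have h2 := countGE_compl_add A t
  omega

theorem GaleComparable.compl {A : Finset (Fin n)} (hA : GaleComparable A) :
    GaleComparable Aᶜ := by
  intro S hS
  have hS' : Sᶜ.card = A.card := by
    have := A.card_le_univ
    rw [Finset.card_compl] at hS ⊢
    omega
  rw [← compl_compl S]
  simp only [countGE_compl_le_iff]
  exact (hA _ hS').symm

theorem GaleComparable.dominated_eq {J A : Finset (Fin n)} (hA : GaleComparable A)
    (hcard : J.card = A.card) : dominated J A =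
      {z : Equiv.Perm (Fin n) | valueSum (J.image z) ≤ valueSum A} := by
  ext z
  have hz : (J.image z).card = A.card := by
    rw [Finset.card_image_of_injective _ z.injective, hcard]
  exact ⟨valueSum_le_of_countGE_le hz, hA.countGE_le hz⟩

theorem GaleComparable.convexHull_dominated {J A : Finset (Fin n)} (hA : GaleComparable A)
    (hcard : J.card = A.card) : convexHull ℝ (permPoint '' dominated J A) =
      permutahedron n ∩ {x | coordSum J x ≤ (valueSum A : ℝ) + A.card} := by
  rw [hA.dominated_eq hcard, permutahedron_inter_halfSpace hcard]

theorem coordSum_add_coordSum_compl (J A : Finset (Fin n)) {x : Fin n → ℝ}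
    (hx : x ∈ permutahedron n) : coordSum J x + coordSum Jᶜ x =
      ((valueSum A : ℝ) + A.card) + ((valueSum Aᶜ : ℝ) + Aᶜ.card) := by
  have hsub : permutahedron n ⊆ {x | coordSum Finset.univ x = ∑ k : Fin n, ((k : ℝ) + 1)} := by
    refine convexHull_min ?_ (convex_hyperplane (coordSum Finset.univ).isLinear _)
    rintro _ ⟨z, rfl⟩
    rw [Set.mem_ofPred_eq, coordSum_apply]
    exact Equiv.sum_comp z fun k : Fin n => ((k : ℝ) + 1)
  have h := hsub hx
  rw [Set.mem_ofPred_eq, coordSum_apply, ← Finset.sum_add_sum_compl J,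
    ← Finset.sum_add_sum_compl A] at h
  rw [coordSum_apply, coordSum_apply, h]
  simp [valueSum, Finset.sum_add_distrib]

/-- The coordinate sum is constant on the permutahedron, so `≥` for `J` and `A` is `≤` for the
complements. -/
theorem GaleComparable.convexHull_dominated_compl {J A : Finset (Fin n)}
    (hA : GaleComparable A) (hcard : J.card = A.card) :
    convexHull ℝ (permPoint '' dominated Jᶜ Aᶜ) =
      permutahedron n ∩ {x | (valueSum A : ℝ) + A.card ≤ coordSum J x} := by
  rw [hA.compl.convexHull_dominated (by rw [Finset.card_compl, Finset.card_compl, hcard])]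
  ext x
  simp only [Set.mem_inter_iff, Set.mem_ofPred_eq, and_congr_right_iff]
  intro hx
  have := coordSum_add_coordSum_compl J A hx
  constructor <;> intro h <;> linarith

theorem GaleComparable.isHyperplaneSplit {J A : Finset (Fin n)} (hA : GaleComparable A)
    (hcard : J.card = A.card) {z₁ z₂ : Equiv.Perm (Fin n)}
    (hz₁ : valueSum (J.image z₁) < valueSum A) (hz₂ : valueSum A < valueSum (J.image z₂)) :
    IsHyperplaneSplit (permutahedron n) (coordSum J) ((valueSum A : ℝ) + A.card)
      (convexHull ℝ (permPoint '' dominated J A))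
      (convexHull ℝ (permPoint '' dominated Jᶜ Aᶜ)) := by
  refine isHyperplaneSplit_of_convexHull finite_range_permPoint ?_
    (Set.image_subset_range _ _) (Set.image_subset_range _ _) _ _
    (hA.convexHull_dominated hcard) (hA.convexHull_dominated_compl hcard)
    ⟨z₁, rfl⟩ ⟨z₂, rfl⟩ ?_ ?_
  · rintro _ ⟨z, rfl⟩
    exact permPoint_mem_extremePoints z
  · rw [coordSum_permPoint, hcard]
    exact add_lt_add_left (by exact_mod_cast hz₁) _
  · rw [coordSum_permPoint, hcard]
    exact add_lt_add_left (by exact_mod_cast hz₂) _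

theorem bruhatIntervalPolytope_one (A : Finset (Fin n)) :
    bruhatIntervalPolytope 1 (decThenOmega A) =
      convexHull ℝ (permPoint '' dominated (initialPositions n A.card) A) := by
  unfold bruhatIntervalPolytope
  congr 2
  ext z
  exact ⟨fun h => bruhatLE_decThenOmega_iff.1 h.2,
    fun h => ⟨one_bruhatLE z, bruhatLE_decThenOmega h⟩⟩

theorem bruhatIntervalPolytope_longestPerm (A : Finset (Fin n)) :
    bruhatIntervalPolytope (incThenE A) (longestPerm n) =
      convexHull ℝ (permPoint '' dominated (initialPositions n A.card)ᶜ Aᶜ) := by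
  unfold bruhatIntervalPolytope
  congr 2
  ext z
  exact ⟨fun h => incThenE_bruhatLE_iff.1 h.1,
    fun h => ⟨incThenE_bruhatLE_iff.2 h, bruhatLE_longestPerm z⟩⟩

theorem image_one_initialPositions (j : ℕ) :
    (initialPositions n j).image (1 : Equiv.Perm (Fin n)) = finInterval n 0 j := by
  ext p; simp [initialPositions, finInterval]

theorem image_longestPerm_initialPositions (j : ℕ) :
    (initialPositions n j).image (longestPerm n) = finInterval n (n - j) n := by
  ext p
  simp only [initialPositions, finInterval, longestPerm, Finset.mem_image, Finset.mem_filter,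
    Finset.mem_univ, true_and, Fin.revPerm_apply]
  constructor
  · rintro ⟨q, hq, rfl⟩
    have := q.isLt
    rw [Fin.val_rev]; omega
  · intro h
    refine ⟨p.rev, ?_, Fin.rev_rev p⟩
    rw [Fin.val_rev]; omega

/-- `A` is neither the first nor the last set of its size in the Gale order. -/
def GaleInterior (A : Finset (Fin n)) : Prop :=
  valueSum (finInterval n 0 A.card) < valueSum A ∧
    valueSum A < valueSum (finInterval n (n - A.card) n)

theorem splitsIntoLPFMs_coordSum {A : Finset (Fin n)} (hA : GaleComparable A)
    (hint : GaleInterior A) :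
    SplitsIntoLPFMs n (coordSum (initialPositions n A.card)) ((valueSum A : ℝ) + A.card)
      1 (decThenOmega A) (incThenE A) (longestPerm n) := by
  have hn : A.card ≤ n := by simpa using A.card_le_univ
  have hcard := card_initialPositions hn
  have hcompl : Aᶜ.card = n - A.card := by rw [Finset.card_compl, Fintype.card_fin]
  refine ⟨?_, one_bruhatLE _, bruhatLE_longestPerm _, ?_, ?_⟩
  · rw [bruhatIntervalPolytope_one, bruhatIntervalPolytope_longestPerm]
    refine hA.isHyperplaneSplit hcard (z₁ := 1) (z₂ := longestPerm n) ?_ ?_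
    · rw [image_one_initialPositions]; exact hint.1
    · rw [image_longestPerm_initialPositions]; exact hint.2
  · rw [bruhatIntervalPolytope_one]
    exact isLPFMPolytope_initial rfl (hA.convexHull_dominated hcard)
  · rw [bruhatIntervalPolytope_longestPerm]
    exact isLPFMPolytope_final hn hcompl (hA.compl.convexHull_dominated
      (by rw [Finset.card_compl, hcard, hcompl, Fintype.card_fin]))

/-- The same split in terms of the last coordinates. -/
theorem splitsIntoLPFMs_coordSum_compl {A : Finset (Fin n)} (hA : GaleComparable A)
    (hint : GaleInterior A) :
    SplitsIntoLPFMs n (coordSum (initialPositions n A.card)ᶜ) ((valueSum Aᶜ : ℝ) + Aᶜ.card)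
      (incThenE A) (longestPerm n) 1 (decThenOmega A) := by
  have hn : A.card ≤ n := by simpa using A.card_le_univ
  have hcard := card_initialPositions hn
  have hs := splitsIntoLPFMs_coordSum hA hint
  have hcard' : (initialPositions n A.card)ᶜ.card = Aᶜ.card := by
    rw [Finset.card_compl, Finset.card_compl, hcard]
  refine ⟨?_, hs.le_right, hs.le_left, hs.lpfm_right, hs.lpfm_left⟩
  have hlt : ∀ z : Equiv.Perm (Fin n), coordSum (initialPositions n A.card) (permPoint z)
      = (valueSum ((initialPositions n A.card).image z) : ℝ) + A.card := fun z => by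
    rw [coordSum_permPoint, hcard]
  have hadd : ∀ z : Equiv.Perm (Fin n),
      (valueSum ((initialPositions n A.card).image z) : ℝ) +
        valueSum ((initialPositions n A.card)ᶜ.image z) = valueSum A + valueSum Aᶜ := fun z => by
    have := coordSum_add_coordSum_compl (initialPositions n A.card) A
      (subset_convexHull ℝ _ ⟨z, rfl⟩ : permPoint z ∈ permutahedron n)
    rw [coordSum_permPoint, coordSum_permPoint, hcard, hcard'] at this
    linarith
  -- Passing to complements exchanges the two sides, and with them the roles of `ω` and `e` as
  -- witnesses.
  have hkey := hA.compl.isHyperplaneSplit hcard' (z₁ := longestPerm n) (z₂ := 1) ?_ ?_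
  · rw [compl_compl, compl_compl] at hkey
    rwa [bruhatIntervalPolytope_one, bruhatIntervalPolytope_longestPerm]
  · have h1 := hadd (longestPerm n)
    have h2 := hint.2
    rw [image_longestPerm_initialPositions] at h1
    exact_mod_cast (by
      have h3 : (valueSum A : ℝ) < valueSum (finInterval n (n - A.card) n) := by exact_mod_cast h2
      linarith : (valueSum ((initialPositions n A.card)ᶜ.image (longestPerm n)) : ℝ)
        < valueSum Aᶜ)
  · have h1 := hadd 1
    have h2 := hint.1
    rw [image_one_initialPositions] at h1
    exact_mod_cast (by
      have h3 : (valueSum (finInterval n 0 A.card) : ℝ) < valueSum A := by exact_mod_cast h2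
      linarith : (valueSum Aᶜ : ℝ) <
        valueSum ((initialPositions n A.card)ᶜ.image (1 : Equiv.Perm (Fin n))))

/-- The extreme sets bound every set of their size in the Gale order, so one strict threshold on
each side suffices. -/
theorem galeInterior_of_countGE {A : Finset (Fin n)}
    (h₁ : ∃ t, A.card - t < countGE A t) (h₂ : ∃ t, countGE A t < n - max (n - A.card) t) :
    GaleInterior A := by
  have hn : A.card ≤ n := by simpa using A.card_le_univ
  have e1 : ∀ t, countGE (finInterval n 0 A.card) t = A.card - t := fun t => by
    rw [countGE_finInterval hn, Nat.zero_max]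
  have e2 := fun t => countGE_finInterval (n := n) (l := n - A.card) le_rfl t
  have c1 : (finInterval n 0 A.card).card = A.card := by rw [← countGE_zero, e1]; rfl
  have c2 : (finInterval n (n - A.card) n).card = A.card := by rw [← countGE_zero, e2]; omega
  obtain ⟨t₁, ht₁⟩ := h₁
  obtain ⟨t₂, ht₂⟩ := h₂
  refine ⟨valueSum_lt_of_countGE_lt c1 (fun t => ?_) (t := t₁) (by rwa [e1]),
    valueSum_lt_of_countGE_lt c2.symm (fun t => ?_) (t := t₂) (by rwa [e2])⟩
  · have := countGE_le_add A 0 t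
    rw [countGE_zero, zero_add] at this
    rw [e1]; omega
  · have h1 := countGE_le_sub A t
    have h2 := countGE_le_card A t
    rw [e2]; omega

theorem GaleInterior.compl {A : Finset (Fin n)} (h : GaleInterior A) : GaleInterior Aᶜ := by
  have hn : A.card ≤ n := by simpa using A.card_le_univ
  have hcompl : Aᶜ.card = n - A.card := by rw [Finset.card_compl, Fintype.card_fin]
  have hadd : ∀ S : Finset (Fin n), valueSum S + valueSum Sᶜ = ∑ a : Fin n, (a : ℕ) :=
    fun S => Finset.sum_add_sum_compl S _
  have e1 : finInterval n 0 Aᶜ.card = (finInterval n (n - A.card) n)ᶜ := by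
    ext p
    simp only [finInterval, hcompl, Finset.mem_filter, Finset.mem_univ, true_and,
      Finset.mem_compl]
    omega
  have e2 : finInterval n (n - Aᶜ.card) n = (finInterval n 0 A.card)ᶜ := by
    ext p; simp [finInterval, hcompl, Nat.sub_sub_self hn]
  obtain ⟨h1, h2⟩ := h
  have a1 := hadd A
  have a2 := hadd (finInterval n (n - A.card) n)
  have a3 := hadd (finInterval n 0 A.card)
  rw [GaleInterior, e1, e2]
  omega

end GaleComparable

/-! ### The sets of the three families. -/

section ParticularSets

variable {n : ℕ}

theorem valueSum_finInterval {l r : ℕ} (hr : r ≤ n) :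
    valueSum (finInterval n l r) = ∑ k ∈ Finset.Ico l r, k := by
  unfold valueSum
  have : Finset.Ico l r = (finInterval n l r).image Fin.val := by
    ext k
    simp only [finInterval, Finset.mem_Ico, Finset.mem_image, Finset.mem_filter, Finset.mem_univ,
      true_and]
    constructor
    · intro h; exact ⟨⟨k, by omega⟩, h, rfl⟩
    · rintro ⟨p, h, rfl⟩; exact h
  rw [this, Finset.sum_image fun _ _ _ _ h => Fin.ext h]

theorem setT1_eq {j : ℕ} (hj : 1 ≤ j) :
    setT1 n j = finInterval n 0 (j - 1) ∪ finInterval n j (j + 1) := by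
  ext p
  simp only [setT1, finInterval, Finset.mem_union, Finset.mem_filter, Finset.mem_univ, true_and]
  omega

theorem countGE_setT1 {j : ℕ} (hj : 1 ≤ j) (hjn : j ≤ n - 2) (t : ℕ) :
    countGE (setT1 n j) t = (j - 1 - max 0 t) + (j + 1 - max j t) := by
  rw [setT1_eq hj, countGE_union (disjoint_finInterval (by omega)),
    countGE_finInterval (by omega), countGE_finInterval (by omega)]

theorem card_setT1 {j : ℕ} (hj : 1 ≤ j) (hjn : j ≤ n - 2) : (setT1 n j).card = j := by
  rw [← countGE_zero, countGE_setT1 hj hjn]; omega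

theorem galeComparable_setT1 {j : ℕ} (hj : 1 ≤ j) (hjn : j ≤ n - 2) :
    GaleComparable (setT1 n j) := by
  intro S hS
  rw [card_setT1 hj hjn] at hS
  simp only [countGE_setT1 hj hjn]
  -- Counted from zero, `setT1 n j` is `{0, …, j - 2, j}`, the second least set. Either `S` is the
  -- least set `{0, …, j - 1}`, or it has an element at least `j` and lies above.
  rcases Nat.eq_zero_or_pos (countGE S j) with h | h
  · left
    intro t
    rcases le_total t j with ht | ht
    · have h1 := countGE_le_add S t (j - t)
      rw [Nat.add_sub_cancel' ht] at h1
      omega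
    · have := countGE_anti S ht
      omega
  · right
    intro t
    have h1 := countGE_le_add S 0 t
    rw [countGE_zero, zero_add] at h1
    rcases le_total t j with ht | ht
    · have := countGE_anti S ht
      omega
    · rcases ht.eq_or_lt with rfl | ht
      · omega
      · omega

theorem galeInterior_setT1 {j : ℕ} (hj : 1 ≤ j) (hjn : j ≤ n - 2) :
    GaleInterior (setT1 n j) := by
  refine galeInterior_of_countGE ⟨j, ?_⟩ ⟨j + 1, ?_⟩ <;>
    rw [card_setT1 hj hjn, countGE_setT1 hj hjn] <;> omega

/-- For `j = i + 1`: the summands are the values below `j - 1`, the value `j`, and the shift by one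
on each of `j` positions. -/
theorem sum_range_add_eq_choose (i : ℕ) :
    ∑ k ∈ Finset.range i, k + (i + 1) + (i + 1) = (i + 1 + 1).choose 2 + 1 := by
  induction i with
  | zero => rfl
  | succ i ih =>
    have h : (i + 1 + 1 + 1).choose 2 = (i + 1 + 1) + (i + 1 + 1).choose 2 := by
      rw [Nat.choose_succ_succ' (i + 1 + 1) 1, Nat.choose_one_right]
    rw [Finset.sum_range_succ, h]
    omega

theorem valueSum_setT1 {j : ℕ} (hj : 1 ≤ j) (hjn : j ≤ n - 2) :
    valueSum (setT1 n j) + j = (j + 1).choose 2 + 1 := by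
  have h : valueSum (setT1 n j)
      = valueSum (finInterval n 0 (j - 1)) + valueSum (finInterval n j (j + 1)) := by
    rw [setT1_eq hj]
    exact Finset.sum_union (disjoint_finInterval (by omega))
  rw [h, valueSum_finInterval (by omega), valueSum_finInterval (by omega)]
  obtain ⟨i, rfl⟩ : ∃ i, j = i + 1 := ⟨j - 1, by omega⟩
  rw [Nat.Ico_succ_singleton, Finset.sum_singleton, ← Finset.range_eq_Ico, Nat.add_sub_cancel]
  exact sum_range_add_eq_choose i

theorem setT2_eq (j : ℕ) :
    setT2 n j = finInterval n (n - j - 1) (n - j) ∪ finInterval n (n - j + 1) n := by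
  ext p
  simp only [setT2, finInterval, Finset.mem_union, Finset.mem_filter, Finset.mem_univ, true_and]
  have := p.isLt
  omega

theorem countGE_setT2 (j t : ℕ) :
    countGE (setT2 n j) t = (n - j - max (n - j - 1) t) + (n - max (n - j + 1) t) := by
  rw [setT2_eq j, countGE_union (disjoint_finInterval (by omega)),
    countGE_finInterval (by omega), countGE_finInterval (by omega)]

theorem card_setT2 {j : ℕ} (hj : 1 ≤ j) (hjn : j ≤ n - 2) : (setT2 n j).card = j := by
  rw [← countGE_zero, countGE_setT2]; omega

theorem galeComparable_setT2 {j : ℕ} (hj : 1 ≤ j) (hjn : j ≤ n - 2) :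
    GaleComparable (setT2 n j) := by
  intro S hS
  rw [card_setT2 hj hjn] at hS
  simp only [countGE_setT2]
  -- In the second case `S` is the greatest set `{n - j, …, n - 1}`; any other set lies below `setT2
  -- n j`, the second greatest.
  rcases lt_or_ge (countGE S (n - j)) j with h | h
  · left
    intro t
    have h1 := countGE_le_sub S t
    have h2 := countGE_le_card S t
    rcases le_total (n - j) t with ht | ht
    · have := countGE_anti S ht
      omega
    · rcases ht.eq_or_lt with rfl | ht
      · omega
      · omega
  · right
    intro t
    rcases le_total (n - j) t with ht | ht
    · have h1 := countGE_le_add S (n - j) (t - (n - j))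
      rw [Nat.add_sub_cancel' ht] at h1
      omega
    · have := countGE_anti S ht
      omega

theorem galeInterior_setT2 {j : ℕ} (hj : 1 ≤ j) (hjn : j ≤ n - 2) :
    GaleInterior (setT2 n j) := by
  refine galeInterior_of_countGE ⟨n - j - 1, ?_⟩ ⟨n - j, ?_⟩ <;>
    rw [card_setT2 hj hjn, countGE_setT2] <;> omega

theorem sum_Ico_add_eq_sum_range {m : ℕ} (hm : m ≤ n) :
    (∑ k ∈ Finset.Ico (n - m) n, (k : ℝ)) + m = ∑ k ∈ Finset.range m, ((n : ℝ) - (k : ℝ)) := by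
  induction m with
  | zero => simp
  | succ m ih =>
    rw [Finset.sum_range_succ, ← ih (by omega), Finset.sum_eq_sum_Ico_succ_bot (by omega)]
    have h : n - (m + 1) + 1 = n - m := by omega
    rw [h, Nat.cast_sub hm]
    push_cast
    ring

theorem valueSum_setT2 {j : ℕ} (hj : 1 ≤ j) (hjn : j ≤ n - 2) :
    (valueSum (setT2 n j) : ℝ) + j =
      (∑ k ∈ Finset.range (j - 1), ((n : ℝ) - (k : ℝ))) + ((n : ℝ) - (j : ℝ)) := by
  have h : valueSum (setT2 n j) = valueSum (finInterval n (n - j - 1) (n - j))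
      + valueSum (finInterval n (n - j + 1) n) := by
    rw [setT2_eq j]
    exact Finset.sum_union (disjoint_finInterval (by omega))
  obtain ⟨i, rfl⟩ : ∃ i, j = i + 1 := ⟨j - 1, by omega⟩
  rw [h, valueSum_finInterval (by omega), valueSum_finInterval le_rfl, Nat.add_sub_cancel,
    ← sum_Ico_add_eq_sum_range (by omega)]
  have h1 : n - (i + 1) + 1 = n - i := by omega
  have h2 : Finset.Ico (n - (i + 1) - 1) (n - (i + 1)) = {n - (i + 1) - 1} := by
    ext k; simp only [Finset.mem_Ico, Finset.mem_singleton]; omega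
  rw [h1, h2, Finset.sum_singleton, Nat.sub_sub]
  push_cast [Nat.cast_sub (show i + 1 + 1 ≤ n by omega)]
  ring

theorem setT3_eq {r : ℕ} (hr : 1 ≤ r) : setT3 n r = finInterval n (r - 1) r := by
  ext p
  simp only [setT3, finInterval, Finset.mem_filter, Finset.mem_univ, true_and]
  omega

theorem countGE_setT3 {r : ℕ} (hr : 1 ≤ r) (hrn : r ≤ n) (t : ℕ) :
    countGE (setT3 n r) t = r - max (r - 1) t := by
  rw [setT3_eq hr, countGE_finInterval hrn]

theorem card_setT3 {r : ℕ} (hr : 1 ≤ r) (hrn : r ≤ n) : (setT3 n r).card = 1 := by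
  rw [← countGE_zero, countGE_setT3 hr hrn]; omega

theorem galeComparable_setT3 {r : ℕ} (hr : 1 ≤ r) (hrn : r ≤ n) :
    GaleComparable (setT3 n r) := by
  intro S hS
  rw [card_setT3 hr hrn] at hS
  simp only [countGE_setT3 hr hrn]
  rcases Nat.eq_zero_or_pos (countGE S (r - 1)) with h | h
  · left
    intro t
    have h1 := countGE_le_card S t
    rcases le_total (r - 1) t with ht | ht
    · have := countGE_anti S ht
      omega
    · rcases ht.eq_or_lt with rfl | ht
      · omega
      · omega
  · right
    intro t
    rcases le_total (r - 1) t with ht | ht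
    · rcases ht.eq_or_lt with rfl | ht <;> omega
    · have := countGE_anti S ht
      omega

theorem galeInterior_setT3 {r : ℕ} (hr : 2 ≤ r) (hrn : r ≤ n - 1) :
    GaleInterior (setT3 n r) := by
  refine galeInterior_of_countGE ⟨r - 1, ?_⟩ ⟨r, ?_⟩ <;>
    rw [card_setT3 (by omega) (by omega), countGE_setT3 (by omega) (by omega)] <;> omega

theorem valueSum_setT3 {r : ℕ} (hr : 1 ≤ r) (hrn : r ≤ n) :
    valueSum (setT3 n r) = r - 1 := by
  rw [setT3_eq hr, valueSum_finInterval hrn]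
  have h : Finset.Ico (r - 1) r = {r - 1} := by
    ext k; simp only [Finset.mem_Ico, Finset.mem_singleton]; omega
  rw [h, Finset.sum_singleton]

theorem proj_zero_eq (h : 0 < n) :
    (LinearMap.proj (⟨0, h⟩ : Fin n) : (Fin n → ℝ) →ₗ[ℝ] ℝ) =
      coordSum (initialPositions n 1) := by
  have : initialPositions n 1 = {⟨0, h⟩} := by
    ext p; simp [mem_initialPositions, Fin.ext_iff]
  rw [this, coordSum, Finset.sum_singleton]

theorem proj_last_eq (h : n - 1 < n) :
    (LinearMap.proj (⟨n - 1, h⟩ : Fin n) : (Fin n → ℝ) →ₗ[ℝ] ℝ) =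
      coordSum (initialPositions n (n - 1))ᶜ := by
  have : (initialPositions n (n - 1))ᶜ = {⟨n - 1, h⟩} := by
    ext p
    have := p.isLt
    simp only [Finset.mem_compl, mem_initialPositions, Finset.mem_singleton, Fin.ext_iff]
    omega
  rw [this, coordSum, Finset.sum_singleton]

end ParticularSets

theorem theorem3p8 (n : ℕ) (hn : 3 ≤ n) :
    (∀ j : ℕ, 1 ≤ j → j ≤ n - 2 →
      SplitsIntoLPFMs n (prefixSum n j) (((j + 1).choose 2 : ℝ) + 1)
        1 (decThenOmega (setT1 n j)) (incThenE (setT1 n j)) (longestPerm n)) ∧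
    (∀ j : ℕ, 1 ≤ j → j ≤ n - 2 →
      SplitsIntoLPFMs n (prefixSum n j)
        ((∑ k ∈ Finset.range (j - 1), ((n : ℝ) - (k : ℝ))) + ((n : ℝ) - (j : ℝ)))
        1 (decThenOmega (setT2 n j)) (incThenE (setT2 n j)) (longestPerm n)) ∧
    (∀ r : ℕ, 2 ≤ r → r ≤ n - 1 →
      SplitsIntoLPFMs n (LinearMap.proj (⟨0, by omega⟩ : Fin n)) (r : ℝ)
        1 (decThenOmega (setT3 n r)) (incThenE (setT3 n r)) (longestPerm n)) ∧
    (∀ r : ℕ, 2 ≤ r → r ≤ n - 1 →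
      SplitsIntoLPFMs n (LinearMap.proj (⟨n - 1, by omega⟩ : Fin n)) (r : ℝ)
        (eThenInc (setT3 n r)) (longestPerm n) 1 (omegaThenDec (setT3 n r))) := by
  refine ⟨fun j hj hjn => ?_, fun j hj hjn => ?_, fun r hr hrn => ?_, fun r hr hrn => ?_⟩
  · have h := splitsIntoLPFMs_coordSum (galeComparable_setT1 hj hjn) (galeInterior_setT1 hj hjn)
    rw [card_setT1 hj hjn, ← Nat.cast_add, valueSum_setT1 hj hjn, Nat.cast_add, Nat.cast_one] at h
    -- `prefixSum n j` is definitionally this `coordSum`, since `i < j` unfolds to `i + 1 ≤ j`.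
    exact h
  · have h := splitsIntoLPFMs_coordSum (galeComparable_setT2 hj hjn) (galeInterior_setT2 hj hjn)
    rw [card_setT2 hj hjn, valueSum_setT2 hj hjn] at h
    exact h
  · have h := splitsIntoLPFMs_coordSum
      (galeComparable_setT3 (n := n) (by omega : 1 ≤ r) (by omega)) (galeInterior_setT3 hr hrn)
    rw [card_setT3 (by omega) (by omega), valueSum_setT3 (by omega) (by omega), ← Nat.cast_add,
      Nat.sub_add_cancel (by omega)] at h
    rw [proj_zero_eq]
    exact h
  -- Apply the split to the first `n - 1` positions and the complement of `{r}`; the complementary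
  -- position is the last one.
  · have h := splitsIntoLPFMs_coordSum_compl
      (galeComparable_setT3 (n := n) (by omega : 1 ≤ r) (by omega)).compl
      (galeInterior_setT3 hr hrn).compl
    rw [compl_compl, Finset.card_compl, Fintype.card_fin, card_setT3 (by omega) (by omega),
      valueSum_setT3 (by omega) (by omega), ← Nat.cast_add, Nat.sub_add_cancel (by omega)] at h
    rw [proj_last_eq, eThenInc_eq, omegaThenDec_eq]
    exact h
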